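/- **Setting.** Memory consists of words grouped into blocks of $B\ge 1$ consecutive words. There are $p\ge 1$ cores, each with a private, initially empty cache of $M\ge B$ words (room for $\lfloor M/B\rfloor$ blocks) with an optimal replacement policy. Accessing a block that is not in the core's cache is a cache miss; re-reads caused only by other cores' writes into a block (block misses) are not counted. A *BP (balanced parallel) computation* is given by a finite binary tree $T$. Each node is the start of a task. A leaf performs $O(1)$ computation; an inner node performs $O(1)$ computation (the task head), forks its two children, and after both have completed performs $O(1)$ further computation (the up-pass). Each node declares $O(1)$ local variables, accessed only within its task; the global variables have total size $O(|T|)$; every variable that is ever written is accessed $O(1)$ times. The size $|\tau|$ of a task $\tau$ is the number of words it (with all its subtasks) accesses; if $r\ge1$ is the size of the root task, every task at level $i$ has size between $c_1\alpha^i r$ and $c_2\alpha^i r$, where $0<\alpha<1$ and $0<c_1\le 1\le c_2$ are constants. It is *$f$-cache friendly* if for every task $\tau$ the words accessed by $\tau$ lie in $O(|\tau|/B+f(|\tau|))$ blocks. Here $f:[1,\infty)\to[0,\infty)$ is nondecreasing. *Sequential execution:* one core runs $T$ depth first, left to right. *Work stealing:* the root task is given to one core. After a task head, the core puts the right child at the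 bottom of its queue and continues with the left child. When it completes a task whose sibling is still on its queue, it continues with the sibling; otherwise, if the sibling has been completed, it continues with the up-pass at the parent, and if not, it becomes idle. Idle cores steal tasks from the heads of queues. *PWS (priority work stealing)* gives tasks priorities that decrease with depth: only a task of the current round's priority may be stolen, which is the highest priority among the tasks that are on a queue or are about to be put on an empty queue by the core that is executing their parent's head. The relative speeds of the cores, and the choice among stealable tasks of equal priority, are arbitrary. **Lemma.** Let $\Pi$ be an $f$-cache friendly BP computation with $f(r)=O(r/B)$ for $r\ge (2c_1/c_2)M$, and let $Q$ be the number of cache misses in its sequential execution. Then in every execution of $\Pi$ under PWS on $p$ cores, the total number of cache misses of all cores satisfies the following bounds. (i) It is $$O\Big(Q+p\big(\tfrac MB+\log B\big)+\sum_{j\ge 0,\ 2M\alpha^j\ge 1}p\cdot f(2M\alpha^j)\Big).$$ (ii) If $M\ge B\log B$ and $f(r)=O(1)$, it is $O(Q+pM/B)$. (iii) If $M\ge B^2$ and $f(r)=O(\sqrt r)$, it is $O(Q+pM/B)$. The constants in the conclusions depend only on $\alpha,c_1,c_2$ and the constants implicit in the hypotheses, and not on $p,M,B,f,\Pi$ or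 the execution. Logarithms are to base 2. -/

import Mathlib

noncomputable section

namespace PWS

/-! ### Computations -/

/-- One access to a variable (variables are named by natural numbers). -/
structure Access where
  var : ℕ
  isWrite : Bool

/-- A binary forking computation tree. A node is the start of a task. A leaf declares local
variables and runs its code. An inner node declares local variables, runs its task head, forks its
two children, and after both have completed runs its up-pass code `tail`. Code is given by the
sequence of the variable accesses it makes. -/
inductive BPTree where
  | leaf (locals : Finset ℕ) (code : List Access)
  | fork (locals : Finset ℕ) (head tail : List Access) (left right : BPTree)

/-- A node of a tree, as the path to it read from the node up to the root: `[]` is the root,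
`false :: u` is the left child of `u` and `true :: u` its right child. Thus the length of the list
is the depth, and the ancestors of a node (itself included) are the suffixes of the list. -/
abbrev Node := List Bool

namespace BPTree

/-- The sequence of accesses in the sequential execution, which ignores the forks. -/
def seq : BPTree → List Access
  | leaf _ code => code
  | fork _ head tail l r => head ++ l.seq ++ r.seq ++ tail

/-- The number of nodes. -/
def numNodes : BPTree → ℕ
  | leaf _ _ => 1
  | fork _ _ _ l r => 1 + l.numNodes + r.numNodes

/-- The local variables declared at the root. -/
def locals : BPTree → Finset ℕ
  | leaf L _ => L
  | fork L _ _ _ _ => L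

/-- The local variables declared at any node. -/
def allLocals : BPTree → Finset ℕ
  | leaf L _ => L
  | fork L _ _ l r => L ∪ l.allLocals ∪ r.allLocals

/-- The accesses made by the root node itself, not by its subtasks. -/
def own : BPTree → List Access
  | leaf _ code => code
  | fork _ head tail _ _ => head ++ tail

/-- The accessed variables that are declared at no node. -/
def globals (T : BPTree) : Finset ℕ := (T.seq.map Access.var).toFinset \ T.allLocals

/-- The left (`false`) or right (`true`) subtree. -/
def child : BPTree → Bool → Option BPTree
  | leaf _ _, _ => none
  | fork _ _ _ l _, false => some l
  | fork _ _ _ _ r, true => some r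

/-- The task that starts at node `u`; `none` if `T` has no such node. -/
def task (T : BPTree) : Node → Option BPTree
  | [] => some T
  | b :: u => (T.task u).bind fun τ => τ.child b

/-- Each piece of code of the root node has at most `K` steps. -/
def CodeBound (K : ℝ) : BPTree → Prop
  | leaf _ code => (code.length : ℝ) ≤ K
  | fork _ head tail _ _ => (head.length : ℝ) ≤ K ∧ (tail.length : ℝ) ≤ K

/-- The words of memory accessed by a task, where variable `x` is stored in the word `addr x`. -/
def words (addr : ℕ → ℕ) (τ : BPTree) : Finset ℕ := (τ.seq.map fun a => addr a.var).toFinset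

/-- The size of a task: the number of words it accesses. -/
def size (addr : ℕ → ℕ) (τ : BPTree) : ℕ := (τ.words addr).card

/-- The blocks (of `B` consecutive words) that contain the words accessed by a task. -/
def blocks (addr : ℕ → ℕ) (B : ℕ) (τ : BPTree) : Finset ℕ := (τ.words addr).image (· / B)

end BPTree

/-- `T`, with its variables stored according to `addr`, is a balanced parallel (BP) computation
with balance parameters `α`, `c₁`, `c₂`, where `K` bounds all the quantities required to be
`O(1)`. -/
structure IsBP (T : BPTree) (addr : ℕ → ℕ) (K α c₁ c₂ : ℝ) : Prop where
  size_pos : 0 < T.size addr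
  /-- Task heads, leaves and up-pass nodes perform `O(1)` computation. -/
  code_le : ∀ u τ, T.task u = some τ → τ.CodeBound K
  /-- Each node declares `O(1)` local variables. -/
  locals_le : ∀ u τ, T.task u = some τ → (τ.locals.card : ℝ) ≤ K
  /-- A variable is declared at most once. -/
  locals_unique : ∀ u v τ σ x, T.task u = some τ → T.task v = some σ →
    x ∈ τ.locals → x ∈ σ.locals → u = v
  /-- A local variable is accessed only by the task that declares it and its subtasks. -/
  locals_scope : ∀ u v τ σ x, T.task u = some τ → T.task v = some σ →
    x ∈ τ.locals → x ∈ σ.own.map Access.var → u <:+ v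
  /-- The global variables (input and output arrays) have total size `O(|T|)`. -/
  globals_le : (T.globals.card : ℝ) ≤ K * T.numNodes
  /-- Limited access: a variable that is ever written is accessed `O(1)` times. -/
  limited_access : ∀ x, (∃ a ∈ T.seq, a.var = x ∧ a.isWrite = true) →
    ((T.seq.map Access.var).count x : ℝ) ≤ K
  /-- Distinct variables are stored in distinct words, except that stack space may be reused by
  local variables of nodes neither of which is an ancestor of the other. -/
  addr_inj : ∀ x ∈ T.globals ∪ T.allLocals, ∀ y ∈ T.globals ∪ T.allLocals,
    addr x = addr y → x ≠ y →
      ∃ u v τ σ, T.task u = some τ ∧ T.task v = some σ ∧ x ∈ τ.locals ∧ y ∈ σ.locals ∧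
        ¬ u <:+ v ∧ ¬ v <:+ u
  /-- Balance: a task at level `i` has size `αⁱ r`, up to constant factors, for `r` the size of
  the root task. -/
  balance : ∀ u τ, T.task u = some τ →
    c₁ * α ^ u.length * T.size addr ≤ τ.size addr ∧
      (τ.size addr : ℝ) ≤ c₂ * α ^ u.length * T.size addr

/-- `f`-cache friendliness: every task `τ` accesses words in `O(|τ|/B + f(|τ|))` blocks. -/
def CacheFriendly (T : BPTree) (addr : ℕ → ℕ) (B : ℕ) (K : ℝ) (f : ℝ → ℝ) : Prop :=
  ∀ u τ, T.task u = some τ →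
    ((τ.blocks addr B).card : ℝ) ≤ K * ((τ.size addr : ℝ) / B + f (τ.size addr))

/-! ### Caches -/

/-- `CacheRun k S t m`: with a cache that has room for `k` blocks and holds the blocks in `S` at
the start, the sequence `t` of block requests can be served with exactly `m` cache misses. On a
miss the requested block is brought in, and blocks are evicted in any way to make room for it. -/
inductive CacheRun (k : ℕ) : Finset ℕ → List ℕ → ℕ → Prop where
  | nil (S : Finset ℕ) : CacheRun k S [] 0
  | hit {S : Finset ℕ} {b : ℕ} {t : List ℕ} {m : ℕ} (hb : b ∈ S) (h : CacheRun k S t m) :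
      CacheRun k S (b :: t) m
  | miss {S : Finset ℕ} {b : ℕ} {t : List ℕ} {m : ℕ} (S' : Finset ℕ) (hb : b ∉ S)
      (hS' : S' ⊆ insert b S) (hb' : b ∈ S') (hk : S'.card ≤ k) (h : CacheRun k S' t m) :
      CacheRun k S (b :: t) (m + 1)

/-- The number of cache misses that a sequence of accesses incurs in an initially empty cache of
`M` words, organized in blocks of `B` words, under an optimal replacement policy. -/
def cacheMisses (M B : ℕ) (addr : ℕ → ℕ) (t : List Access) : ℕ :=
  sInf {m | CacheRun (M / B) ∅ (t.map fun a => addr a.var / B) m}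

/-- The number of cache misses in the sequential execution. -/
def seqMisses (M B : ℕ) (addr : ℕ → ℕ) (T : BPTree) : ℕ := cacheMisses M B addr T.seq

/-! ### Priority work stealing -/

/-- What a core is doing: nothing, the code of node `u` in the downpass (its task head, or all of
its code if it is a leaf), or the code of node `u` in the up-pass. -/
inductive Activity where
  | idle
  | down (u : Node)
  | up (u : Node)

/-- A state of an execution on `p` cores. -/
structure State (p : ℕ) where
  /-- the current activity of each core -/
  act : Fin p → Activity
  /-- the task queue of each core, from its top (head) to its bottom -/
  queue : Fin p → List Node
  /-- the accesses made so far by each core, in chronological order -/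
  trace : Fin p → List Access
  /-- the completed tasks -/
  done : Set Node

/-- At the start, core `c₀` is given the root task. -/
def State.init {p : ℕ} (c₀ : Fin p) : State p where
  act := Function.update (fun _ => .idle) c₀ (.down [])
  queue := fun _ => []
  trace := fun _ => []
  done := ∅

open Classical in
/-- Core `c` makes the accesses `t`, which completes task `u`. If the sibling of `u` is still at
the bottom of its queue, it takes that task from there and goes on with it. Otherwise, if the
sibling has been completed, it goes on with the up-pass at the parent; else it becomes idle. -/
def State.finish {p : ℕ} (s : State p) (c : Fin p) (t : List Access) : Node → State p
  | [] =>
    { act := Function.update s.act c .idle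
      queue := s.queue
      trace := Function.update s.trace c (s.trace c ++ t)
      done := insert [] s.done }
  | b :: v =>
    { act := Function.update s.act c
        (if (s.queue c).getLast? = some ((!b) :: v) then .down ((!b) :: v)
         else if ((!b) :: v) ∈ s.done then .up v else .idle)
      queue := Function.update s.queue c
        (if (s.queue c).getLast? = some ((!b) :: v) then (s.queue c).dropLast else s.queue c)
      trace := Function.update s.trace c (s.trace c ++ t)
      done := insert (b :: v) s.done }

/-- Priorities decrease with depth. `s.Available T d` says that in state `s` a task of depth `d` is
on some queue, or that a core with an empty queue is at a node of depth `d - 1` whose children it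
has not yet forked, so that it is about to put a task of depth `d` on its queue. -/
def State.Available {p : ℕ} (T : BPTree) (s : State p) (d : ℕ) : Prop :=
  ∃ c, (∃ v ∈ s.queue c, v.length = d) ∨
    (s.queue c = [] ∧ ∃ u L head tail l r, s.act c = .down u ∧
      T.task u = some (.fork L head tail l r) ∧ d = u.length + 1)

/-- The current round has the highest priority that is available, that is, the least depth. -/
def State.IsRound {p : ℕ} (T : BPTree) (s : State p) (d : ℕ) : Prop :=
  s.Available T d ∧ ∀ d', s.Available T d' → d ≤ d'

/-- One step of one core under priority work stealing. -/
inductive Step {p : ℕ} (T : BPTree) (s : State p) : State p → Prop where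
  /-- Run a task head, place the right child at the bottom of the queue, go on with the left. -/
  | fork (c : Fin p) (u : Node) (L : Finset ℕ) (head tail : List Access) (l r : BPTree)
      (hact : s.act c = .down u) (hu : T.task u = some (.fork L head tail l r)) :
      Step T s
        { act := Function.update s.act c (.down (false :: u))
          queue := Function.update s.queue c (s.queue c ++ [true :: u])
          trace := Function.update s.trace c (s.trace c ++ head)
          done := s.done }
  /-- Run a leaf. -/
  | leaf (c : Fin p) (u : Node) (L : Finset ℕ) (code : List Access)
      (hact : s.act c = .down u) (hu : T.task u = some (.leaf L code)) :
      Step T s (s.finish c code u)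
  /-- Run the up-pass code of a node. -/
  | up (c : Fin p) (u : Node) (L : Finset ℕ) (head tail : List Access) (l r : BPTree)
      (hact : s.act c = .up u) (hu : T.task u = some (.fork L head tail l r)) :
      Step T s (s.finish c tail u)
  /-- The idle core `c` steals the task at the head of the queue of core `c'`; this task has to
  have the priority of the current round. -/
  | steal (c c' : Fin p) (v : Node) (q : List Node)
      (hact : s.act c = .idle) (hq : s.queue c' = v :: q) (hround : s.IsRound T v.length) :
      Step T s
        { act := Function.update s.act c (.down v)
          queue := Function.update s.queue c' q
          trace := s.trace
          done := s.done }

/-- `s` is the final state of a complete execution of `T` under priority work stealing on `p`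
cores that starts at core `c₀`. The order in which the cores make their steps, that is, their
relative speed, and the choice among tasks of the same priority are arbitrary. -/
def IsPWSExecution {p : ℕ} (T : BPTree) (c₀ : Fin p) (s : State p) : Prop :=
  Relation.ReflTransGen (Step T) (State.init c₀) s ∧ [] ∈ s.done

/-- The total number of cache misses of all cores, each with a private cache of `M` words. -/
def pwsMisses {p : ℕ} (M B : ℕ) (addr : ℕ → ℕ) (s : State p) : ℕ :=
  ∑ c, cacheMisses M B addr (s.trace c)

end PWS

end

/-! Each core is compared with the sequential execution. When a core is given the root task or
steals a task, a segment begins. Until it climbs above that task, the core runs code that the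
sequential execution runs too, in the same order, with omissions where subtasks were stolen. So it
can imitate the sequential cache, and pays extra only for its deficit: the blocks accessed by the
segment's task that the sequential cache holds and its own does not. By `Run.simulate`, imitating a
piece of code costs at most the sequential misses plus the drop of the deficit. The deficit is
created at a steal, and it jumps when a core goes on with an up-pass past a right child that was
stolen and has already been completed; the jump is the gap, the blocks that this child brought into
the sequential cache. Each of the two costs at most the number of blocks of the stolen task. An
up-pass above the segment's task, a climb, is paid in full, which is `O(1)`. The resulting bound is
`GReach.pwsMisses_le`.

The priorities limit the numbers of these events. There are at most `p` steals at each depth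
(`GReach.card_stolen_le`): once `d` is the least depth on offer, no core newly comes to offer a task
of depth `d`, and each steal at this depth uses up one offering core. There are at most `2p` climbs
at each depth `i` (`GReach.card_climbed_le`): a climb either comes from a stolen child, or concerns
one of at most `p` nodes that are unfinished when the first task of depth at least `i + 2` is
stolen.

There may still be many levels of tasks that are large compared with the cache. There the sequential
run is replaced by one that empties its cache at the start and the end of each task
(`exists_flushed_labels`). A task of at least `2M` words misses at least `⌊M/B⌋` times anyway, so
this costs only a constant factor in `Q`, while the steals at these levels become free, and so do
the climbs except at the last of these levels.

At the remaining levels the sizes are at most `(c₂/c₁) 2M α^j`. The terms `size/B` form a geometric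
series with sum `O(M/B)`, the terms `f(size)` form the series of the statement up to a shift by a
bounded number of levels, and the climbs cost `O(p)` per level for `O(M/B + log B)` levels. In (ii)
and (iii), `log B ≤ M/B`; the sum of `f` is at most a constant times the number of levels in (ii),
and a geometric series of ratio `√α` in (iii). -/

namespace PWS

/-! ### Cache runs that record the final cache contents -/

/-- `Run k S t m S₁`: the requests `t` can be served from cache contents `S` with at most `m`
misses so that the blocks of `S₁` are in the cache at the end. -/
inductive Run (k : ℕ) : Finset ℕ → List ℕ → ℕ → Finset ℕ → Prop where
  | nil {S S₁ : Finset ℕ} (h : S₁ ⊆ S) : Run k S [] 0 S₁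
  | hit {S S₁ : Finset ℕ} {b : ℕ} {t : List ℕ} {m : ℕ} (hb : b ∈ S) (h : Run k S t m S₁) :
      Run k S (b :: t) m S₁
  | miss {S S₁ : Finset ℕ} {b : ℕ} {t : List ℕ} {m : ℕ} (S' : Finset ℕ)
      (hS' : S' ⊆ insert b S) (hb' : b ∈ S') (hk : S'.card ≤ k) (h : Run k S' t m S₁) :
      Run k S (b :: t) (m + 1) S₁

namespace Run

variable {k m m' : ℕ} {S S₁ S₂ S' X : Finset ℕ} {t t' : List ℕ}

theorem mono (h : Run k S t m S₁) : ∀ {S'}, S ⊆ S' → Run k S' t m S₁ := by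
  induction h with
  | nil h => intro S' hS; exact .nil (h.trans hS)
  | hit hb _ ih => intro S' hS; exact .hit (hS hb) (ih hS)
  | miss S₂ h1 h2 h3 h ih =>
    intro S' hS
    exact .miss S₂ (h1.trans (Finset.insert_subset_insert _ hS)) h2 h3 h

theorem append (h : Run k S t m S₁) (h' : Run k S₁ t' m' S₂) :
    Run k S (t ++ t') (m + m') S₂ := by
  induction h with
  | nil h => simpa using h'.mono h
  | hit hb _ ih => exact .hit hb (ih h')
  | miss S₃ h1 h2 h3 _ ih =>
    have := Run.miss S₃ h1 h2 h3 (ih h')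
    rwa [Nat.add_right_comm] at this

theorem split : ∀ {t : List ℕ} {S : Finset ℕ} {m : ℕ}, Run k S (t ++ t') m S₂ →
    ∃ S₁ m₁ m₂, Run k S t m₁ S₁ ∧ Run k S₁ t' m₂ S₂ ∧ m = m₁ + m₂
  | [], S, m, h => ⟨S, 0, m, .nil subset_rfl, h, by simp⟩
  | b :: t, S, m, h => by
    cases h with
    | hit hb h =>
      obtain ⟨S₁, m₁, m₂, h1, h2, h3⟩ := split h
      exact ⟨S₁, m₁, m₂, .hit hb h1, h2, h3⟩
    | miss S' hS hb hk h =>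
      obtain ⟨S₁, m₁, m₂, h1, h2, h3⟩ := split h
      exact ⟨S₁, m₁ + 1, m₂, .miss S' hS hb hk h1, h2, by omega⟩

theorem card_le (h : Run k S t m S₁) (hS : S.card ≤ k) : S₁.card ≤ k := by
  induction h with
  | nil h => exact (Finset.card_le_card h).trans hS
  | hit _ _ ih => exact ih hS
  | miss _ _ _ hk _ ih => exact ih hk

theorem subset_union (h : Run k S t m S₁) : S₁ ⊆ S ∪ t.toFinset := by
  induction h with
  | nil h => simpa using h
  | hit _ _ ih => exact ih.trans (by intro x; simp; tauto)
  | miss S' hS _ _ _ ih =>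
    intro x hx
    have := ih hx
    simp only [Finset.mem_union, List.mem_toFinset, List.mem_cons] at this ⊢
    rcases this with h | h
    · have := hS h
      simp at this
      tauto
    · tauto

/-- A requested block is present at the start or is missed at least once. -/
theorem card_toFinset_le (h : Run k S t m S₁) : t.toFinset.card ≤ S.card + m := by
  suffices (t.toFinset \ S).card ≤ m by
    have := Finset.card_le_card_sdiff_add_card (s := t.toFinset) (t := S)
    omega
  induction h with
  | nil => simp
  | @hit S S₁ b t m hb _ ih =>
    refine (Finset.card_le_card ?_).trans ih
    intro x; simp; rintro (rfl | h) h'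
    · exact absurd hb h'
    · exact ⟨h, h'⟩
  | @miss S S₁ b t m S' hS _ _ _ ih =>
    have : (b :: t).toFinset \ S ⊆ insert b (t.toFinset \ S') := by
      intro x; simp; rintro (rfl | h) h'
      · exact .inl rfl
      · by_cases hx : x = b
        · exact .inl hx
        · refine .inr ⟨h, fun h2 => ?_⟩
          have := hS h2
          simp [hx] at this
          exact h' this
    have := (Finset.card_le_card this).trans (Finset.card_insert_le _ _)
    omega

/-- Only the current block is kept. The final contents `∅` promise nothing, which is how an emptied
cache is expressed. -/
theorem all_miss (hk : 1 ≤ k) : ∀ (t : List ℕ) (S : Finset ℕ), Run k S t t.length ∅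
  | [], _ => .nil (Finset.empty_subset _)
  | b :: t, S => .miss {b} (by simp) (by simp) (by simpa using hk) (all_miss hk t {b})

/-- More contents only turn misses into hits. The miss rule of `Run` also admits a block that is
present; such a step becomes a hit. -/
theorem exists_cacheRun (h : Run k S t m S₁) : ∀ {S'}, S ⊆ S' → ∃ m' ≤ m, CacheRun k S' t m' := by
  induction h with
  | nil => intro S' _; exact ⟨0, le_rfl, .nil _⟩
  | hit hb _ ih =>
    intro S' hS
    obtain ⟨m', h1, h2⟩ := ih hS
    exact ⟨m', h1, .hit (hS hb) h2⟩
  | @miss S S₁ b t m S₂ h1 h2 h3 _ ih =>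
    intro S' hS
    by_cases hb : b ∈ S'
    · obtain ⟨m', h4, h5⟩ := ih (S' := S')
        (h1.trans (Finset.insert_subset hb hS))
      exact ⟨m', by omega, .hit hb h5⟩
    · obtain ⟨m', h4, h5⟩ := ih (S' := S₂) subset_rfl
      exact ⟨m' + 1, by omega, .miss S₂ hb (h1.trans (Finset.insert_subset_insert _ hS)) h2 h3 h5⟩

/-- Simulation of a run from other cache contents: only the relevant blocks (those of `X`) that
are absent have to be paid for. -/
theorem simulate (h : Run k S t m S₁) (hS : S.card ≤ k) (hX : ∀ b ∈ t, b ∈ X) :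
    ∀ S', ∃ m' S₁', Run k S' t m' S₁' ∧
      m' + ((S₁ ∩ X) \ S₁').card ≤ m + ((S ∩ X) \ S').card := by
  induction h with
  | nil h =>
    intro S'
    refine ⟨0, S', .nil subset_rfl, ?_⟩
    have := Finset.card_le_card (Finset.sdiff_subset_sdiff (Finset.inter_subset_inter_right h (u := X))
      (subset_refl S'))
    omega
  | @hit S S₁ b t m hb _ ih =>
    intro S'
    have hbX : b ∈ X := hX b (by simp)
    have hX' : ∀ b ∈ t, b ∈ X := fun c hc => hX c (by simp [hc])
    by_cases hb' : b ∈ S'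
    · obtain ⟨m', S₁', h1, h2⟩ := ih hS hX' S'
      exact ⟨m', S₁', .hit hb' h1, h2⟩
    -- Only the imitating run misses. The block `b` leaves the deficit and thereby pays for the
    -- miss; intersecting with `S` keeps the contents within `k` blocks.
    · obtain ⟨m', S₁', h1, h2⟩ := ih hS hX' (insert b (S' ∩ S))
      refine ⟨m' + 1, S₁', .miss _ ?_ (by simp) ?_ h1, ?_⟩
      · exact Finset.insert_subset_insert _ Finset.inter_subset_left
      · exact (Finset.card_le_card (Finset.insert_subset hb Finset.inter_subset_right)).trans hS
      · have : insert b ((S ∩ X) \ insert b (S' ∩ S)) ⊆ (S ∩ X) \ S' := by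
          intro x; simp; rintro (rfl | h)
          · exact ⟨⟨hb, hbX⟩, hb'⟩
          · tauto
        have h3 := Finset.card_le_card this
        rw [Finset.card_insert_of_notMem (by simp)] at h3
        omega
  | @miss S S₁ b t m S₂ h1 h2 h3 _ ih =>
    intro S'
    have hX' : ∀ b ∈ t, b ∈ X := fun c hc => hX c (by simp [hc])
    by_cases hb' : b ∈ S'
    · obtain ⟨m', S₁', h4, h5⟩ := ih h3 hX' S'
      refine ⟨m', S₁', .hit hb' h4, ?_⟩
      have : (S₂ ∩ X) \ S' ⊆ (S ∩ X) \ S' := by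
        intro x; simp; intro hx hxX hx'
        have := h1 hx
        simp at this
        rcases this with rfl | h
        · exact absurd hb' hx'
        · tauto
      have := Finset.card_le_card this
      omega
    -- Both runs miss. Keeping whatever part of `S₂` is at hand adds no deficit, since apart from
    -- `b` all of `S₂` was already in `S`.
    · obtain ⟨m', S₁', h4, h5⟩ := ih h3 hX' (S₂ ∩ insert b S')
      refine ⟨m' + 1, S₁', .miss _ Finset.inter_subset_right (by simp [h2]) ?_ h4, ?_⟩
      · exact (Finset.card_le_card Finset.inter_subset_left).trans h3
      · have : (S₂ ∩ X) \ (S₂ ∩ insert b S') ⊆ (S ∩ X) \ S' := by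
          intro x; simp; intro hx hxX hx'
          have h6 := hx' hx
          have := h1 hx
          simp at this
          tauto
        have := Finset.card_le_card this
        omega

end Run

theorem CacheRun.exists_run {k m : ℕ} {S : Finset ℕ} {t : List ℕ} (h : CacheRun k S t m) :
    ∃ S₁, Run k S t m S₁ := by
  induction h with
  | nil S => exact ⟨S, .nil subset_rfl⟩
  | hit hb _ ih => exact ih.imp fun _ h => .hit hb h
  | miss S' _ h1 h2 h3 _ ih => exact ih.imp fun _ h => .miss S' h1 h2 h3 h

/-- The blocks requested by a sequence of accesses. -/
def reqs (addr : ℕ → ℕ) (B : ℕ) (t : List Access) : List ℕ := t.map fun a => addr a.var / B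

theorem reqs_append (addr : ℕ → ℕ) (B : ℕ) (t t' : List Access) :
    reqs addr B (t ++ t') = reqs addr B t ++ reqs addr B t' := List.map_append

theorem length_reqs (addr : ℕ → ℕ) (B : ℕ) (t : List Access) :
    (reqs addr B t).length = t.length := List.length_map ..

theorem cacheMisses_le_of_run {M B m : ℕ} {addr : ℕ → ℕ} {t : List Access} {S₁ : Finset ℕ}
    (h : Run (M / B) ∅ (reqs addr B t) m S₁) : cacheMisses M B addr t ≤ m := by
  obtain ⟨m', h1, h2⟩ := h.exists_cacheRun subset_rfl
  exact (Nat.sInf_le h2).trans h1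

theorem exists_run_cacheMisses {M B : ℕ} (addr : ℕ → ℕ) (t : List Access) (hk : 1 ≤ M / B) :
    ∃ S₁, Run (M / B) ∅ (reqs addr B t) (cacheMisses M B addr t) S₁ := by
  -- Some run has to exist for the infimum to be attained: `sInf ∅` would be the default value 0.
  obtain ⟨m', -, h2⟩ := (Run.all_miss hk (reqs addr B t) ∅).exists_cacheRun subset_rfl
  exact CacheRun.exists_run (Nat.sInf_mem (s := {m | CacheRun (M / B) ∅ _ m}) ⟨m', h2⟩)

theorem BPTree.blocks_eq (addr : ℕ → ℕ) (B : ℕ) (τ : BPTree) :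
    τ.blocks addr B = (reqs addr B τ.seq).toFinset := by
  ext x
  simp [BPTree.blocks, BPTree.words, reqs]

theorem BPTree.size_le_mul_card_blocks (addr : ℕ → ℕ) {B : ℕ} (hB : 1 ≤ B) (τ : BPTree) :
    τ.size addr ≤ B * (τ.blocks addr B).card := by
  refine Finset.card_le_mul_card_image _ _ fun b _ => ?_
  have : (τ.words addr).filter (fun x => x / B = b) ⊆ Finset.Ico (b * B) (b * B + B) := by
    intro x hx
    simp only [Finset.mem_filter] at hx
    have h1 := Nat.div_add_mod x B
    have h2 := Nat.mod_lt x hB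
    rw [hx.2, mul_comm] at h1
    simp only [Finset.mem_Ico]
    omega
  simpa using Finset.card_le_card this

/-! ### Nodes and tasks -/

theorem suffix_cases {u v : Node} (h : u <:+ v) : v = u ∨ ∃ b, b :: u <:+ v := by
  obtain ⟨l, rfl⟩ := h
  rcases l.eq_nil_or_concat with rfl | ⟨l, b, rfl⟩
  · exact .inl rfl
  · exact .inr ⟨b, l, by simp⟩

theorem cons_suffix_unique {u v : Node} {b b' : Bool} (h : b :: u <:+ v) (h' : b' :: u <:+ v) :
    b = b' := by
  have := List.suffix_of_suffix_length_le h h' (by simp)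
  rcases List.suffix_cons_iff.1 this with h | h
  · simpa using h
  · have := h.length_le
    simp at this

theorem not_cons_suffix (b : Bool) (u : Node) : ¬ b :: u <:+ u := fun h => by
  simpa using h.length_le

theorem cons_suffix_cons_iff {b b' : Bool} {u : Node} : b :: u <:+ b' :: u ↔ b = b' :=
  ⟨fun h => cons_suffix_unique h List.suffix_rfl, fun h => h ▸ List.suffix_rfl⟩

namespace BPTree

variable {T τ σ : BPTree} {u v : Node}

theorem task_cons_fork {L head tail l r} (h : T.task u = some (fork L head tail l r)) :
    T.task (false :: u) = some l ∧ T.task (true :: u) = some r := by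
  simp [task, h, child]

theorem task_cons_leaf {L code} (h : T.task u = some (leaf L code)) (b : Bool) :
    T.task (b :: u) = none := by
  cases b <;> simp [task, h, child]

theorem task_cons_some {b : Bool} (h : T.task (b :: u) = some τ) :
    ∃ L head tail l r, T.task u = some (fork L head tail l r) := by
  rcases hu : T.task u with _ | σ
  · simp [task, hu] at h
  · cases σ with
    | leaf L code => simp [task_cons_leaf hu] at h
    | fork L head tail l r => exact ⟨L, head, tail, l, r, rfl⟩

theorem task_isSome_sibling {b : Bool} (b' : Bool) (h : (T.task (b :: u)).isSome) :
    (T.task (b' :: u)).isSome := by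
  obtain ⟨τ, h⟩ := Option.isSome_iff_exists.1 h
  obtain ⟨L, head, tail, l, r, hu⟩ := task_cons_some h
  cases b' <;> simp [task_cons_fork hu]

/-- The blocks accessed by the task at a node (none if there is no such node). -/
def blocksAt (T : BPTree) (addr : ℕ → ℕ) (B : ℕ) (u : Node) : Finset ℕ :=
  (T.task u).elim ∅ (·.blocks addr B)

theorem blocksAt_eq (addr : ℕ → ℕ) (B : ℕ) (h : T.task u = some τ) :
    T.blocksAt addr B u = τ.blocks addr B := by simp [blocksAt, h]

theorem blocksAt_cons_subset (addr : ℕ → ℕ) (B : ℕ) (b : Bool) :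
    T.blocksAt addr B (b :: u) ⊆ T.blocksAt addr B u := by
  rcases h : T.task (b :: u) with _ | τ
  · simp [blocksAt, h]
  · obtain ⟨L, head, tail, l, r, hu⟩ := task_cons_some h
    have := task_cons_fork hu
    cases b <;>
    · rw [blocksAt_eq addr B (by first | exact this.1 | exact this.2), blocksAt_eq addr B hu,
        blocks_eq, blocks_eq]
      intro x
      simp only [seq, reqs_append, List.mem_toFinset, List.mem_append]
      tauto

theorem blocksAt_subset (addr : ℕ → ℕ) (B : ℕ) (h : v <:+ u) :
    T.blocksAt addr B u ⊆ T.blocksAt addr B v := by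
  induction u with
  | nil => simp_all
  | cons b u ih =>
    rcases List.suffix_cons_iff.1 h with rfl | h
    · rfl
    · exact (blocksAt_cons_subset addr B b).trans (ih h)

/-- The nodes of the task `τ` at node `u`. -/
def nodes : Node → BPTree → Finset Node
  | u, leaf _ _ => {u}
  | u, fork _ _ _ l r => insert u (nodes (false :: u) l ∪ nodes (true :: u) r)

theorem mem_nodes_self (u : Node) (τ : BPTree) : u ∈ nodes u τ := by cases τ <;> simp [nodes]

theorem nodes_task_subset (h : T.task u = some τ) : nodes u τ ⊆ nodes [] T := by
  induction u generalizing τ with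
  | nil => simp [task] at h; simp [h]
  | cons b u ih =>
    obtain ⟨L, head, tail, l, r, hu⟩ := task_cons_some h
    refine Finset.Subset.trans ?_ (ih hu)
    have := task_cons_fork hu
    cases b
    · obtain rfl : l = τ := by simpa [this.1] using h
      intro x; simp [nodes]; tauto
    · obtain rfl : r = τ := by simpa [this.2] using h
      intro x; simp [nodes]; tauto

theorem mem_nodes_of_task (h : T.task u = some τ) : u ∈ nodes [] T :=
  nodes_task_subset h (mem_nodes_self u τ)

end BPTree

/-! ### Cache contents along the sequential execution -/

/-- The cache contents before and after a task, and the misses of its head (or leaf) code and of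
its up-pass code. -/
structure Label where
  inn : Finset ℕ
  out : Finset ℕ
  md : ℕ
  mu : ℕ

/-- The labels `A` describe an execution of the task `τ` at node `u` on one core. -/
def Valid (k B : ℕ) (addr : ℕ → ℕ) (A : Node → Label) : Node → BPTree → Prop
  | u, .leaf _ code => (A u).inn.card ≤ k ∧ (A u).out.card ≤ k ∧
      Run k (A u).inn (reqs addr B code) (A u).md (A u).out
  | u, .fork _ head tail l r => (A u).inn.card ≤ k ∧ (A u).out.card ≤ k ∧
      Run k (A u).inn (reqs addr B head) (A u).md (A (false :: u)).inn ∧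
      (A (true :: u)).inn = (A (false :: u)).out ∧
      Run k (A (true :: u)).out (reqs addr B tail) (A u).mu (A u).out ∧
      Valid k B addr A (false :: u) l ∧ Valid k B addr A (true :: u) r

/-- The total number of misses of the task `τ` at node `u` according to the labels. -/
def weight (A : Node → Label) : Node → BPTree → ℕ
  | u, .leaf _ _ => (A u).md + (A u).mu
  | u, .fork _ _ _ l r =>
    (A u).md + (A u).mu + weight A (false :: u) l + weight A (true :: u) r

section Labels

variable {k B : ℕ} {addr : ℕ → ℕ} {A A' : Node → Label} {u : Node} {T τ : BPTree}

theorem Valid.congr (hA : ∀ v, u <:+ v → A v = A' v) (h : Valid k B addr A u τ) :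
    Valid k B addr A' u τ := by
  induction τ generalizing u with
  | leaf L code => simpa [Valid, hA u List.suffix_rfl] using h
  | fork L head tail l r ihl ihr =>
    have h0 : ∀ b, ∀ v, b :: u <:+ v → A v = A' v := fun b v hv =>
      hA v ((List.suffix_cons b u).trans hv)
    simp only [Valid, ← hA u List.suffix_rfl, ← h0 _ _ List.suffix_rfl] at h ⊢
    exact ⟨h.1, h.2.1, h.2.2.1, h.2.2.2.1, h.2.2.2.2.1, ihl (h0 _) h.2.2.2.2.2.1,
      ihr (h0 _) h.2.2.2.2.2.2⟩

theorem weight_congr (hA : ∀ v, u <:+ v → A v = A' v) : weight A u τ = weight A' u τ := by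
  induction τ generalizing u with
  | leaf L code => simp [weight, hA u List.suffix_rfl]
  | fork L head tail l r ihl ihr =>
    have h0 : ∀ b, ∀ v, b :: u <:+ v → A v = A' v := fun b v hv =>
      hA v ((List.suffix_cons b u).trans hv)
    simp only [weight, hA u List.suffix_rfl, ihl (h0 _), ihr (h0 _)]

theorem Valid.card_out (h : Valid k B addr A u τ) : (A u).out.card ≤ k := by
  cases τ <;> exact h.2.1

theorem Valid.task (h : Valid k B addr A [] T) (hu : T.task u = some τ) :
    Valid k B addr A u τ := by
  induction u generalizing τ with
  | nil => simp [BPTree.task] at hu; rwa [← hu]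
  | cons b u ih =>
    obtain ⟨L, head, tail, l, r, h'⟩ := BPTree.task_cons_some hu
    have h1 := ih h'
    have := BPTree.task_cons_fork h'
    cases b
    · obtain rfl : l = τ := by simpa [this.1] using hu
      exact h1.2.2.2.2.2.1
    · obtain rfl : r = τ := by simpa [this.2] using hu
      exact h1.2.2.2.2.2.2

/-- A task brings in only blocks that it accesses, so the gap of a stolen task is at most its number
of blocks. -/
theorem Valid.out_subset (h : Valid k B addr A u τ) :
    (A u).out ⊆ (A u).inn ∪ τ.blocks addr B := by
  induction τ generalizing u with
  | leaf L code => simpa [BPTree.blocks_eq, BPTree.seq] using h.2.2.subset_union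
  | fork L head tail l r ihl ihr =>
    obtain ⟨-, -, h1, h2, h3, h4, h5⟩ := h
    intro x hx
    have e1 := Finset.subset_iff.1 h1.subset_union (x := x)
    have e2 := Finset.subset_iff.1 (ihl h4) (x := x)
    have e3 := Finset.subset_iff.1 (ihr h5) (x := x)
    have e4 := h3.subset_union hx
    simp only [BPTree.blocks_eq, BPTree.seq, reqs_append, Finset.mem_union, List.mem_toFinset,
      List.mem_append, h2] at *
    tauto

/-- An inequality suffices, and it makes the disjointness of the two subtrees unnecessary. -/
theorem sum_nodes_le_weight (A : Node → Label) (u : Node) (τ : BPTree) :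
    ∑ v ∈ BPTree.nodes u τ, ((A v).md + (A v).mu) ≤ weight A u τ := by
  induction τ generalizing u with
  | leaf L code => simp [BPTree.nodes, weight]
  | fork L head tail l r ihl ihr =>
    have h1 : ∀ (s : Finset Node) (g : Node → ℕ), ∑ v ∈ insert u s, g v ≤ g u + ∑ v ∈ s, g v := by
      intro s g
      by_cases hu : u ∈ s
      · simp [Finset.insert_eq_of_mem hu]
      · rw [Finset.sum_insert hu]
    have h2 : ∀ (s t : Finset Node) (g : Node → ℕ),
        ∑ v ∈ s ∪ t, g v ≤ ∑ v ∈ s, g v + ∑ v ∈ t, g v := by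
      intro s t g
      rw [← Finset.sum_union_inter]; omega
    have h3 := h1 (BPTree.nodes (false :: u) l ∪ BPTree.nodes (true :: u) r)
      (fun v => (A v).md + (A v).mu)
    have h4 := h2 (BPTree.nodes (false :: u) l) (BPTree.nodes (true :: u) r)
      (fun v => (A v).md + (A v).mu)
    have := ihl (false :: u)
    have := ihr (true :: u)
    simp only [BPTree.nodes, weight] at *
    omega

/-- Labels for the node `u` and for the subtrees of its children. -/
def glue (u : Node) (a : Label) (Al Ar : Node → Label) (v : Node) : Label :=
  if v = u then a else if false :: u <:+ v then Al v else Ar v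

theorem glue_self (u : Node) (a : Label) (Al Ar : Node → Label) : glue u a Al Ar u = a := by
  simp [glue]

theorem glue_left {u v : Node} (a : Label) (Al Ar : Node → Label) (h : false :: u <:+ v) :
    glue u a Al Ar v = Al v := by
  have : v ≠ u := by rintro rfl; exact not_cons_suffix _ _ h
  simp [glue, this, h]

theorem glue_right {u v : Node} (a : Label) (Al Ar : Node → Label) (h : true :: u <:+ v) :
    glue u a Al Ar v = Ar v := by
  have h1 : v ≠ u := by rintro rfl; exact not_cons_suffix _ _ h
  have h2 : ¬ false :: u <:+ v := fun h' => by simpa using cons_suffix_unique h h'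
  simp [glue, h1, h2]

theorem valid_glue {L : Finset ℕ} {head tail : List Access} {l r : BPTree} {a : Label}
    {Al Ar : Node → Label} (h1 : a.inn.card ≤ k) (h2 : a.out.card ≤ k)
    (h3 : Run k a.inn (reqs addr B head) a.md (Al (false :: u)).inn)
    (h4 : (Ar (true :: u)).inn = (Al (false :: u)).out)
    (h5 : Run k (Ar (true :: u)).out (reqs addr B tail) a.mu a.out)
    (hl : Valid k B addr Al (false :: u) l) (hr : Valid k B addr Ar (true :: u) r) :
    Valid k B addr (glue u a Al Ar) u (.fork L head tail l r) ∧
      weight (glue u a Al Ar) u (.fork L head tail l r) =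
        a.md + a.mu + weight Al (false :: u) l + weight Ar (true :: u) r := by
  constructor
  · simp only [Valid, glue_self, glue_left a Al Ar List.suffix_rfl,
      glue_right a Al Ar List.suffix_rfl]
    exact ⟨h1, h2, h3, h4, h5, hl.congr fun v hv => (glue_left a Al Ar hv).symm,
      hr.congr fun v hv => (glue_right a Al Ar hv).symm⟩
  · simp only [weight, glue_self]
    rw [weight_congr fun v hv => glue_left a Al Ar hv,
      weight_congr fun v hv => glue_right a Al Ar hv]

/-- The run is cut wherever one piece of code ends and the next begins; the contents at the cuts are
the labels. -/
theorem exists_labels {S S₁ : Finset ℕ} {m : ℕ} (u : Node) (τ : BPTree)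
    (h : Run k S (reqs addr B τ.seq) m S₁) (hS : S.card ≤ k) :
    ∃ A, Valid k B addr A u τ ∧ (A u).inn = S ∧ (A u).out = S₁ ∧ weight A u τ = m := by
  induction τ generalizing u S S₁ m with
  | leaf L code =>
    exact ⟨fun _ => ⟨S, S₁, m, 0⟩, ⟨hS, h.card_le hS, h⟩, rfl, rfl, by simp [weight]⟩
  | fork L head tail l r ihl ihr =>
    simp only [BPTree.seq, reqs_append] at h
    obtain ⟨S₄, n₃, m₄, h3, h4, rfl⟩ := h.split
    obtain ⟨S₃, n₂, m₃, h2, h3', rfl⟩ := h3.split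
    obtain ⟨S₂, m₁, m₂, h1, h2', rfl⟩ := h2.split
    have c2 := h1.card_le hS
    have c3 := h2'.card_le c2
    have c4 := h3'.card_le c3
    have c5 := h4.card_le c4
    obtain ⟨Al, l1, l2, l3, l4⟩ := ihl (false :: u) h2' c2
    obtain ⟨Ar, r1, r2, r3, r4⟩ := ihr (true :: u) h3' c3
    obtain ⟨g1, g2⟩ := valid_glue (L := L) (a := ⟨S, S₁, m₁, m₄⟩) hS c5 (by simpa [l2] using h1)
      (by simp [l3, r2]) (by simpa [r3] using h4) l1 r1
    exact ⟨_, g1, by simp [glue_self], by simp [glue_self], by rw [g2, l4, r4]; simp; omega⟩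

/-- If all tasks down to depth `i` are large compared with the cache, then the cache may be
flushed at all nodes down to depth `i`, at the cost of a constant factor. -/
theorem exists_flushed_labels {i K : ℕ} (hk : 1 ≤ k)
    (hcode : ∀ u τ, T.task u = some τ → τ.CodeBound K)
    (hbig : ∀ u τ, T.task u = some τ → u.length ≤ i → 2 * k ≤ (τ.blocks addr B).card)
    {S S₁ : Finset ℕ} {m : ℕ} (u : Node) (τ : BPTree) (hu : T.task u = some τ)
    (hui : u.length ≤ i)
    (h : Run k S (reqs addr B τ.seq) m S₁) (hS : S.card ≤ k) :
    ∃ A, Valid k B addr A u τ ∧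
      (∀ v, u <:+ v → v.length ≤ i → (A v).inn = ∅ ∧ (A v).out = ∅) ∧
      (∀ v L head tail l r, u <:+ v → v.length < i →
        T.task v = some (.fork L head tail l r) → tail.length ≤ (A v).mu) ∧
      weight A u τ + 2 * K ≤ (2 + 3 * K) * m := by
  -- At least `2 * k` distinct blocks are requested and at most `k` were present, so at least `k`
  -- misses occur.
  have hm : ∀ {S S₁ : Finset ℕ} {m : ℕ} (u : Node) (τ : BPTree), T.task u = some τ →
      u.length ≤ i → Run k S (reqs addr B τ.seq) m S₁ → S.card ≤ k → k ≤ m := by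
    intro S S₁ m u τ hu hui h hS
    have h1 := hbig u τ hu hui
    have h2 := h.card_toFinset_le
    rw [← BPTree.blocks_eq] at h2
    omega
  -- The slack `2 * K` carries the induction: the two children bring `4 * K`, half of which pays for
  -- the head and the tail of the emptied node, and half of which is passed on.
  induction τ generalizing u S S₁ m with
  | leaf L code =>
    have h1 := hm u _ hu hui h hS
    have h2 : code.length ≤ K := by simpa [BPTree.CodeBound] using hcode _ _ hu
    have h3 := Run.all_miss hk (reqs addr B code) ∅
    rw [length_reqs] at h3
    refine ⟨fun _ => ⟨∅, ∅, code.length, 0⟩, ⟨by simp, by simp, h3⟩, by simp, ?_, ?_⟩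
    · intro v L head tail l r hv _ hv'
      rcases suffix_cases hv with rfl | ⟨b, hb⟩
      · simp [hu] at hv'
      · exfalso
        have : ∀ v, b :: u <:+ v → T.task v = none := by
          intro v
          induction v with
          | nil => simp
          | cons b' v ih =>
            intro hv
            rcases List.suffix_cons_iff.1 hv with e | hv
            · rw [← e]; exact BPTree.task_cons_leaf hu b
            · simp [BPTree.task, ih hv]
        simp [this v hb] at hv'
    · simp only [weight]; nlinarith
  | fork L head tail l r ihl ihr =>
    have hkm := hm u _ hu hui h hS
    rcases hui.eq_or_lt with hi | hi
    -- At depth `i` the run is imitated from an empty cache, with at most `k ≤ m` additional misses;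
    -- giving up the final contents is free.
    · obtain ⟨m', S₁', h1, h2⟩ := h.simulate (X := (reqs addr B _).toFinset) hS
        (fun b hb => List.mem_toFinset.2 hb) ∅
      have h3 : Run k ∅ (reqs addr B (BPTree.fork L head tail l r).seq) m' ∅ := by
        simpa using h1.append (.nil (Finset.empty_subset _))
      obtain ⟨A, a1, a2, a3, a4⟩ := exists_labels u _ h3 (by simp)
      refine ⟨A, a1, ?_, ?_, ?_⟩
      · intro v hv hvi
        have : u = v := hv.eq_of_length_le (by omega)
        rw [← this]; exact ⟨a2, a3⟩
      · intro v _ _ _ _ _ hv hvi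
        have := hv.length_le
        omega
      · have : ((S ∩ (reqs addr B (BPTree.fork L head tail l r).seq).toFinset) \ ∅).card ≤ k :=
          (Finset.card_le_card (Finset.sdiff_subset.trans Finset.inter_subset_left)).trans hS
        rw [a4]
        nlinarith
    · obtain ⟨tl, tr⟩ := BPTree.task_cons_fork hu
      simp only [BPTree.seq, reqs_append] at h
      obtain ⟨S₄, n₃, m₄, h3, h4, rfl⟩ := h.split
      obtain ⟨S₃, n₂, m₃, h2, h3', rfl⟩ := h3.split
      obtain ⟨S₂, m₁, m₂, h1, h2', rfl⟩ := h2.split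
      have c2 := h1.card_le hS
      have c3 := h2'.card_le c2
      obtain ⟨Al, l1, l2, l3, l4⟩ := ihl (false :: u) tl hi h2' c2
      obtain ⟨Ar, r1, r2, r3, r4⟩ := ihr (true :: u) tr hi h3' c3
      have f1 := l2 _ List.suffix_rfl hi
      have f2 := r2 _ List.suffix_rfl hi
      obtain ⟨hh, ht⟩ : head.length ≤ K ∧ tail.length ≤ K := by
        simpa [BPTree.CodeBound] using hcode _ _ hu
      obtain ⟨g1, g2⟩ := valid_glue (L := L) (a := ⟨∅, ∅, head.length, tail.length⟩)
        (by simp) (by simp)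
        (by simpa [f1, length_reqs] using Run.all_miss hk (reqs addr B head) ∅)
        (by simp [f1, f2])
        (by simpa [f2, length_reqs] using Run.all_miss hk (reqs addr B tail) ∅) l1 r1
      refine ⟨_, g1, ?_, ?_, ?_⟩
      · intro v hv hvi
        rcases suffix_cases hv with rfl | ⟨_ | _, hb⟩
        · simp [glue_self]
        · rw [glue_left _ _ _ hb]; exact l2 v hb hvi
        · rw [glue_right _ _ _ hb]; exact r2 v hb hvi
      · intro v L' head' tail' l' r' hv hvi hv'
        rcases suffix_cases hv with rfl | ⟨_ | _, hb⟩
        · rw [hu] at hv'; simp at hv'; simp [glue_self, hv'.2.2.1]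
        · rw [glue_left _ _ _ hb]; exact l3 v _ _ _ _ _ hb hvi hv'
        · rw [glue_right _ _ _ hb]; exact r3 v _ _ _ _ _ hb hvi hv'
      · rw [g2]
        simp only
        nlinarith

end Labels

/-! ### Queues -/

/-- The core runs code of node `u`. -/
def Activity.At (a : Activity) (u : Node) : Prop := a = .down u ∨ a = .up u

/-- The right siblings of the left children on the path from the root to `u`, from top to
bottom. -/
def lefts : Node → List Node
  | [] => []
  | false :: w => lefts w ++ [true :: w]
  | true :: w => lefts w

theorem mem_lefts {x u : Node} : x ∈ lefts u ↔ ∃ w, x = true :: w ∧ false :: w <:+ u := by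
  induction u with
  | nil => simp [lefts]
  | cons b u ih =>
    cases b
    · simp only [lefts, List.mem_append, List.mem_singleton, ih, List.suffix_cons_iff (a := false)]
      constructor
      · rintro (⟨w, h1, h2⟩ | rfl)
        · exact ⟨w, h1, .inr h2⟩
        · exact ⟨u, rfl, .inl rfl⟩
      · rintro ⟨w, h1, h2 | h2⟩
        · right; simp_all
        · exact .inl ⟨w, h1, h2⟩
    · simp only [lefts, ih, List.suffix_cons_iff (a := true)]
      simp

theorem length_le_of_mem_lefts {x u : Node} (h : x ∈ lefts u) : x.length ≤ u.length := by
  obtain ⟨w, rfl, hw⟩ := mem_lefts.1 h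
  simpa using hw.length_le

theorem pairwise_lefts (u : Node) : (lefts u).Pairwise (·.length < ·.length) := by
  induction u with
  | nil => simp [lefts]
  | cons b u ih =>
    cases b
    · simp only [lefts, List.pairwise_append, ih, List.pairwise_singleton, true_and]
      intro x hx y hy
      have := length_le_of_mem_lefts hx
      simp at hy
      simp [hy]; omega
    · simpa [lefts] using ih

/-- A left child ends the list of its right siblings, so that a suffix of this list is empty or
ends with the sibling of the node. -/
theorem suffix_lefts_false {q : List Node} {w : Node} (h : q <:+ lefts (false :: w)) :
    q = [] ∨ ∃ q', q = q' ++ [true :: w] ∧ q' <:+ lefts w := by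
  obtain ⟨l, hl⟩ := h
  rcases q.eq_nil_or_concat with rfl | ⟨q', x, rfl⟩
  · exact .inl rfl
  · right
    rw [lefts, List.concat_eq_append, ← List.append_assoc] at hl
    obtain ⟨h1, h2⟩ := List.append_inj' hl rfl
    simp at h2
    exact ⟨q', by simp [h2], l, h1⟩

/-! ### The structure of the states of an execution -/

/-- The task at `x` is or was on a queue or has been started. -/
def Known {p : ℕ} (s : State p) (D : Finset Node) (x : Node) : Prop :=
  x ∈ D ∨ (∃ c, s.act c = .down x) ∨ ∃ c, x ∈ s.queue c

/-- The invariants of an execution. Here `D` is the set of the nodes whose downpass code has been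
executed, `Z` the set of the stolen tasks, and `seg c` the task with which core `c` started most
recently. -/
structure Inv {p : ℕ} (T : BPTree) (s : State p) (D Z : Finset Node) (seg : Fin p → Node) :
    Prop where
  idle_queue : ∀ c, s.act c = .idle → s.queue c = []
  -- Thieves take only from the top, so a suffix of the pending right siblings is left.
  queue_suffix : ∀ c u, (s.act c).At u → s.queue c <:+ lefts u
  -- Inside a stolen right child the left sibling may be unfinished, but then the queue holds only
  -- tasks below the right child.
  right_done : ∀ c u, (s.act c).At u → ∀ w, true :: w <:+ u →
    false :: w ∈ s.done ∨ ∀ x ∈ s.queue c, w.length + 1 < x.length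
  down_notMem : ∀ c u, s.act c = .down u → u ∉ D
  up_mem : ∀ c u, s.act c = .up u → u ∈ D ∧ u ∉ s.done ∧ ∀ b, b :: u ∈ s.done
  queue_notMem : ∀ c, ∀ x ∈ s.queue c, x ∉ D ∧ x ∉ Z
  known_isSome : ∀ x, Known s D x → (T.task x).isSome
  known_parent : ∀ b w, Known s D (b :: w) → w ∈ D
  known_child : ∀ b w, w ∈ D → (T.task (b :: w)).isSome → Known s D (b :: w)
  known_of_stolen : ∀ x ∈ Z, Known s D x
  mem_of_done : ∀ x ∈ s.done, x ∈ D
  done_child : ∀ b, ∀ x ∈ s.done, (T.task (b :: x)).isSome → b :: x ∈ s.done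
  down_unique : ∀ c c' u, s.act c = .down u → s.act c' = .down u → c = c'
  up_unique : ∀ c c' u, s.act c = .up u → s.act c' = .up u → c = c'
  queue_unique : ∀ c c' x, x ∈ s.queue c → x ∈ s.queue c' → c = c'
  queue_down : ∀ c c' x, x ∈ s.queue c → s.act c' ≠ .down x
  -- Bounds the number of started, unfinished nodes of one depth by the number of cores.
  live : ∀ w, w ∈ D → w ∉ s.done → ∃ c u, (s.act c).At u ∧ w <:+ u
  seg_down : ∀ c u, s.act c = .down u → seg c <:+ u
  seg_up : ∀ c u, s.act c = .up u → u <:+ seg c ∨ seg c <:+ u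
  seg_queue : ∀ c, ∀ x ∈ s.queue c, seg c <:+ x.tail
  seg_stolen : ∀ c, s.act c ≠ .idle → seg c = [] ∨ seg c ∈ Z
  -- A right child started before its left sibling is complete must have been stolen, which gives
  -- the gap a steal to be charged to.
  stolen : ∀ w, true :: w ∈ D ∨ (∃ c, s.act c = .down (true :: w)) →
    true :: w ∈ Z ∨ false :: w ∈ s.done

section

variable {p : ℕ} {T : BPTree} {s : State p} {D Z : Finset Node} {seg : Fin p → Node}

namespace Inv

theorem exists_at (h : Inv T s D Z seg) {c : Fin p} {x : Node} (hx : x ∈ s.queue c) :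
    ∃ u, (s.act c).At u := by
  rcases ha : s.act c with _ | u | u
  · simp [h.idle_queue c ha] at hx
  · exact ⟨u, .inl rfl⟩
  · exact ⟨u, .inr rfl⟩

theorem queue_mem (h : Inv T s D Z seg) {c : Fin p} {x : Node} (hx : x ∈ s.queue c) :
    ∃ u w, (s.act c).At u ∧ x = true :: w ∧ false :: w <:+ u := by
  obtain ⟨u, hu⟩ := h.exists_at hx
  obtain ⟨w, h1, h2⟩ := mem_lefts.1 ((h.queue_suffix c u hu).subset hx)
  exact ⟨u, w, hu, h1, h2⟩

theorem queue_pairwise (h : Inv T s D Z seg) (c : Fin p) :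
    (s.queue c).Pairwise (·.length < ·.length) := by
  rcases hq : s.queue c with _ | ⟨x, q⟩
  · simp
  · obtain ⟨u, hu⟩ := h.exists_at (c := c) (x := x) (by simp [hq])
    rw [← hq]
    exact (pairwise_lefts u).sublist (h.queue_suffix c u hu).sublist

theorem init (hT : (T.task []).isSome) (c₀ : Fin p) :
    Inv T (State.init c₀) ∅ ∅ fun _ => [] := by
  have ha : ∀ c, (State.init c₀).act c = if c = c₀ then .down [] else .idle := fun c => by
    simp [State.init, Function.update_apply]
  have hq : ∀ c, (State.init c₀).queue c = [] := fun c => rfl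
  have hd : (State.init c₀).done = ∅ := rfl
  generalize State.init c₀ = s at *
  constructor <;> grind [Known, Activity.At, lefts]

theorem fork (h : Inv T s D Z seg) {c : Fin p} {u : Node} {L : Finset ℕ} {head tail : List Access}
    {l r : BPTree} {s' : State p} (hact : s.act c = .down u)
    (hu : T.task u = some (.fork L head tail l r))
    (ha : ∀ c', s'.act c' = if c' = c then .down (false :: u) else s.act c')
    (hq : ∀ c', s'.queue c' = if c' = c then s.queue c ++ [true :: u] else s.queue c')
    (hd : s'.done = s.done) :
    Inv T s' (insert u D) Z seg := by
  have hq' : ∀ x ∈ s.queue c, x.length ≤ u.length := fun x hx =>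
    length_le_of_mem_lefts ((h.queue_suffix c u (.inl hact)).subset hx)
  have huD := h.down_notMem c u hact
  have hk : ∀ x, Known s' (insert u D) x ↔ Known s D x ∨ ∃ b, x = b :: u := by
    clear h
    intro x
    constructor
    · grind [Known]
    · rintro (h | ⟨b, rfl⟩)
      · grind [Known]
      · cases b <;> grind [Known]
  -- The children are fresh: a known child presupposes that the downpass code of its parent has been
  -- run.
  have hch : ∀ b, ¬ Known s D (b :: u) := fun b hb => huD (h.known_parent b u hb)
  constructor
  · have := h.idle_queue; clear h hk hch; grind
  · have := h.queue_suffix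
    have hl : ∀ q, q <:+ lefts u → q ++ [true :: u] <:+ lefts (false :: u) := fun q ⟨l, hl⟩ =>
      ⟨l, by simp [lefts, ← hl]⟩
    clear h hk hch; grind [Activity.At]
  · intro c' v hv w hw
    rw [hq, hd]
    rw [ha] at hv
    split_ifs at hv ⊢ with hc
    · obtain rfl : false :: u = v := by simpa [Activity.At] using hv
      have hw : true :: w <:+ u := by simpa [List.suffix_cons_iff (a := false)] using hw
      have := hw.length_le
      rcases h.right_done c u (.inl hact) w hw with h | h
      · exact .inl h
      · right
        intro x hx
        simp at hx
        rcases hx with hx | rfl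
        · exact h x hx
        · simpa using this
    · exact h.right_done c' v hv w hw
  · intro c' v hv
    rw [ha] at hv
    split_ifs at hv with hc
    · obtain rfl : false :: u = v := by simpa using hv
      simpa using fun h' => hch false (.inl h')
    · have h1 := h.down_notMem c' v hv
      have h2 := h.down_unique c c' u hact
      simp only [Finset.mem_insert, not_or]
      exact ⟨fun e => hc (h2 (e ▸ hv)).symm, h1⟩
  · have := h.up_mem; clear h hk hch; grind
  · intro c' x hx
    rw [hq] at hx
    have h1 := h.queue_notMem c'
    have h2 := h.queue_down c' c u
    have h3 := hch true
    have h4 := h.known_of_stolen (true :: u)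
    clear h hk hch
    grind [Known]
  · intro x hx
    rcases (hk x).1 hx with hx | ⟨b, rfl⟩
    · exact h.known_isSome x hx
    · obtain ⟨tl, tr⟩ := BPTree.task_cons_fork hu
      cases b <;> simp [tl, tr]
  · intro b w hx
    rcases (hk _).1 hx with hx | ⟨b', hb⟩
    · exact Finset.mem_insert_of_mem (h.known_parent b w hx)
    · simp at hb; simp [hb]
  · intro b w hw hb
    rw [hk]
    rcases Finset.mem_insert.1 hw with rfl | hw
    · exact .inr ⟨b, rfl⟩
    · exact .inl (h.known_child b w hw hb)
  · exact fun x hx => (hk x).2 (.inl (h.known_of_stolen x hx))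
  · intro x hx
    rw [hd] at hx
    exact Finset.mem_insert_of_mem (h.mem_of_done x hx)
  · exact hd ▸ h.done_child
  · have h1 := h.down_unique
    have h2 : ∀ c, s.act c ≠ .down (false :: u) := fun c hc => hch false (.inr (.inl ⟨c, hc⟩))
    clear h hk hch; grind
  · have h1 := h.up_unique
    clear h hk hch; grind
  · have h1 := h.queue_unique
    have h2 : ∀ c, true :: u ∉ s.queue c := fun c hc => hch true (.inr (.inr ⟨c, hc⟩))
    clear h hk hch; grind
  · have h1 := h.queue_down
    have h2 : ∀ c, true :: u ∉ s.queue c := fun c hc => hch true (.inr (.inr ⟨c, hc⟩))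
    have h3 : ∀ c, s.act c ≠ .down (true :: u) := fun c hc => hch true (.inr (.inl ⟨c, hc⟩))
    have h4 : ∀ c, false :: u ∉ s.queue c := fun c hc => hch false (.inr (.inr ⟨c, hc⟩))
    clear h hk hch; grind
  · intro w hw hwd
    rw [hd] at hwd
    rcases Finset.mem_insert.1 hw with rfl | hw
    · exact ⟨c, false :: w, .inl (by simp [ha]), List.suffix_cons _ _⟩
    · obtain ⟨c', v, h1, h2⟩ := h.live w hw hwd
      by_cases hc : c' = c
      · subst hc
        obtain rfl : u = v := by simpa [hact, Activity.At] using h1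
        exact ⟨c', false :: u, .inl (by simp [ha]), h2.trans (List.suffix_cons _ _)⟩
      · exact ⟨c', v, by rwa [ha, if_neg hc], h2⟩
  · intro c' v hv
    rw [ha] at hv
    split_ifs at hv with hc
    · obtain rfl : false :: u = v := by simpa using hv
      exact hc ▸ (h.seg_down c u hact).trans (List.suffix_cons _ _)
    · exact h.seg_down c' v hv
  · have := h.seg_up; clear h hk hch; grind
  · have h1 := h.seg_queue; have h2 := h.seg_down c u hact; clear h hk hch; grind
  · have h1 := h.seg_stolen; clear h hk hch; grind
  · intro w hw
    rw [hd]
    have h1 := h.stolen w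
    have h2 := h.stolen w
    have h3 : true :: w = u → true :: w ∈ Z ∨ false :: w ∈ s.done := fun e =>
      h1 (.inr ⟨c, e ▸ hact⟩)
    clear h hk hch; grind

theorem steal (h : Inv T s D Z seg) {c c' : Fin p} {v : Node} {q : List Node}
    {s' : State p} (hact : s.act c = .idle) (hv : s.queue c' = v :: q)
    (ha : ∀ c₁, s'.act c₁ = if c₁ = c then .down v else s.act c₁)
    (hq : ∀ c₁, s'.queue c₁ = if c₁ = c' then q else s.queue c₁)
    (hd : s'.done = s.done) :
    Inv T s' D (insert v Z) (Function.update seg c v) := by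
  have hqc : s.queue c = [] := h.idle_queue c hact
  have hcc : c ≠ c' := by rintro rfl; simp [hqc] at hv
  have hvq : v ∈ s.queue c' := by simp [hv]
  have hvD := h.queue_notMem c' v hvq
  have hvd : ∀ c, s.act c ≠ .down v := fun c => h.queue_down c' c v hvq
  have hvn : ∀ c, v ∉ s'.queue c := by
    intro c₁
    rw [hq]
    split_ifs with hc
    · have := h.queue_pairwise c'
      rw [hv, List.pairwise_cons] at this
      exact fun hx => lt_irrefl _ (this.1 v hx)
    · exact fun hx => hc (h.queue_unique _ _ _ hx hvq)
  have hqs : ∀ c₁, s'.queue c₁ <:+ s.queue c₁ := by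
    intro c₁
    rw [hq]
    split_ifs with hc
    · rw [hc, hv]; exact List.suffix_cons _ _
    · exact List.suffix_rfl
  have hqm : ∀ c₁, ∀ x ∈ s'.queue c₁, x ∈ s.queue c₁ := fun c₁ x hx => (hqs c₁).subset hx
  have hqe : s'.queue c = [] := by rw [hq, if_neg hcc, hqc]
  have hk : ∀ x, Known s' D x ↔ Known s D x := by
    have hqr : ∀ c₁ x, x ∈ s.queue c₁ → x ∈ s'.queue c₁ ∨ x = v := by
      intro c₁ x hx
      rw [hq]
      split_ifs with hc
      · rw [hc, hv] at hx; simp at hx; tauto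
      · exact .inl hx
    intro x
    clear h hvD hqs
    unfold Known
    grind
  constructor
  · intro c₁ h1
    rw [ha] at h1
    split_ifs at h1 with hc
    exact List.suffix_nil.1 (h.idle_queue c₁ h1 ▸ hqs c₁)
  · intro c₁ u h1
    rw [ha] at h1
    split_ifs at h1 with hc
    · rw [hc, hqe]; exact List.nil_suffix
    · exact (hqs c₁).trans (h.queue_suffix c₁ u h1)
  · intro c₁ u h1 w hw
    rw [ha] at h1
    rw [hd]
    split_ifs at h1 with hc
    · rw [hc, hqe]; simp
    · exact (h.right_done c₁ u h1 w hw).imp_right fun h2 x hx => h2 x (hqm c₁ x hx)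
  · intro c₁ u h1
    rw [ha] at h1
    split_ifs at h1 with hc
    · obtain rfl : v = u := by simpa using h1
      exact hvD.1
    · exact h.down_notMem c₁ u h1
  · have := h.up_mem; clear h hk hqs; grind
  · intro c₁ x hx
    obtain ⟨h1, h2⟩ := h.queue_notMem c₁ x (hqm c₁ x hx)
    refine ⟨h1, ?_⟩
    simp only [Finset.mem_insert, not_or]
    exact ⟨fun e => hvn c₁ (e ▸ hx), h2⟩
  · exact fun x hx => h.known_isSome x ((hk x).1 hx)
  · exact fun b w hx => h.known_parent b w ((hk _).1 hx)
  · exact fun b w h1 h2 => (hk _).2 (h.known_child b w h1 h2)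
  · intro x hx
    rcases Finset.mem_insert.1 hx with rfl | hx
    · exact .inr (.inl ⟨c, by simp [ha]⟩)
    · exact (hk x).2 (h.known_of_stolen x hx)
  · exact hd ▸ h.mem_of_done
  · exact hd ▸ h.done_child
  · have := h.down_unique; clear h hk hqs; grind
  · have := h.up_unique; clear h hk hqs; grind
  · exact fun c₁ c₂ x h1 h2 => h.queue_unique c₁ c₂ x (hqm _ _ h1) (hqm _ _ h2)
  · intro c₁ c₂ x h1 h2
    rw [ha] at h2
    split_ifs at h2 with hc
    · simp at h2
      exact hvn c₁ (h2 ▸ h1)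
    · exact h.queue_down c₁ c₂ x (hqm _ _ h1) h2
  · intro w hw hwd
    rw [hd] at hwd
    obtain ⟨c₁, u, h1, h2⟩ := h.live w hw hwd
    refine ⟨c₁, u, ?_, h2⟩
    rw [ha, if_neg]
    · exact h1
    · rintro rfl; simp [hact, Activity.At] at h1
  · have := h.seg_down; clear h hk hqs; grind [Function.update_apply]
  · have := h.seg_up; clear h hk hqs; grind [Function.update_apply]
  · intro c₁ x hx
    have hc : c₁ ≠ c := by rintro rfl; simp [hqe] at hx
    rw [Function.update_of_ne hc]
    exact h.seg_queue c₁ x (hqm c₁ x hx)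
  · have := h.seg_stolen; clear h hk hqs; grind [Function.update_apply]
  · have := h.stolen; clear h hk hqs; grind

theorem eq_of_at (h : Inv T s D Z seg) {c c' : Fin p} {u : Node} (hc : (s.act c).At u)
    (hc' : (s.act c').At u) : c = c' := by
  rcases hc with hc | hc <;> rcases hc' with hc' | hc'
  · exact h.down_unique c c' u hc hc'
  · exact absurd (h.up_mem c' u hc').1 (h.down_notMem c u hc)
  · exact absurd (h.up_mem c u hc).1 (h.down_notMem c' u hc')
  · exact h.up_unique c c' u hc hc'

theorem notMem_done (h : Inv T s D Z seg) {c : Fin p} {u : Node} (hc : (s.act c).At u) :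
    u ∉ s.done := by
  rcases hc with hc | hc
  · exact fun hu => h.down_notMem c u hc (h.mem_of_done u hu)
  · exact (h.up_mem c u hc).2.1

theorem known_at (h : Inv T s D Z seg) {c : Fin p} {u : Node} (hc : (s.act c).At u) :
    Known s D u := by
  rcases hc with hc | hc
  · exact .inr (.inl ⟨c, hc⟩)
  · exact .inl (h.up_mem c u hc).1

/-- Common part of the three continuations after a completed task. The new activity `a'` and queue
`q'` of the core are arbitrary here; the hypotheses list what a continuation has to guarantee. -/
theorem complete (h : Inv T s D Z seg) {c : Fin p} {u : Node} {a' : Activity} {q' : List Node}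
    {s' : State p} (hat : (s.act c).At u)
    (hchild : ∀ b, (T.task (b :: u)).isSome → b :: u ∈ s.done)
    (ha : ∀ c₁, s'.act c₁ = if c₁ = c then a' else s.act c₁)
    (hq : ∀ c₁, s'.queue c₁ = if c₁ = c then q' else s.queue c₁)
    (hd : s'.done = insert u s.done)
    (hqq : ∀ x ∈ q', x ∈ s.queue c)
    (hkn : ∀ x ∈ s.queue c, x ∈ q' ∨ a' = .down x)
    (hidle : a' = .idle → q' = [])
    (hsuf : ∀ w, a'.At w → q' <:+ lefts w)
    (hright : ∀ v, a'.At v → ∀ w, true :: w <:+ v →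
      false :: w ∈ s'.done ∨ ∀ x ∈ q', w.length + 1 < x.length)
    (hdown : ∀ w, a' = .down w → w ∈ s.queue c ∧ w ∉ q')
    (hup : ∀ w, a' = .up w → w ∈ D ∧ w ∉ s'.done ∧ (∀ b, b :: w ∈ s'.done) ∧
      ∀ c₁, s.act c₁ ≠ .up w)
    (hlive : ∀ w ∈ D, w ∉ s'.done → w <:+ u → ∃ c₁ v, (s'.act c₁).At v ∧ w <:+ v)
    (hsup : ∀ w, a' = .up w → w <:+ seg c ∨ seg c <:+ w)
    (hstol : ∀ w, a' = .down (true :: w) → false :: w ∈ s'.done) :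
    Inv T s' (insert u D) Z seg := by
  have hun : ∀ c₁, (s.act c₁).At u → c₁ = c := fun c₁ h1 => h.eq_of_at h1 hat
  have hud := h.notMem_done hat
  have hku := h.known_at hat
  have huq : ∀ c, u ∉ s.queue c := by
    intro c₁ hx
    rcases hat with h1 | h1
    · exact h.queue_down c₁ c u hx h1
    · exact (h.queue_notMem c₁ u hx).1 (h.up_mem c u h1).1
  have hqm : ∀ c₁, ∀ x ∈ s'.queue c₁, x ∈ s.queue c₁ := by
    intro c₁ x hx
    rw [hq] at hx
    split_ifs at hx with hc
    · exact hc ▸ hqq x hx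
    · exact hx
  have hk : ∀ x, Known s' (insert u D) x ↔ Known s D x := by
    clear h hchild hsuf hright hup hlive hsup hstol hidle
    intro x
    constructor
    · rintro (h1 | ⟨c₁, h1⟩ | ⟨c₁, h1⟩)
      · rcases Finset.mem_insert.1 h1 with rfl | h1
        · exact hku
        · exact .inl h1
      · rw [ha] at h1
        split_ifs at h1 with hc
        · exact .inr (.inr ⟨c, (hdown x h1).1⟩)
        · exact .inr (.inl ⟨c₁, h1⟩)
      · exact .inr (.inr ⟨c₁, hqm c₁ x h1⟩)
    · rintro (h1 | ⟨c₁, h1⟩ | ⟨c₁, h1⟩)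
      · exact .inl (Finset.mem_insert_of_mem h1)
      · by_cases hc : c₁ = c
        · left
          have : x = u := by
            rw [hc] at h1
            simpa [h1, Activity.At, eq_comm] using hat
          simp [this]
        · exact .inr (.inl ⟨c₁, by rwa [ha, if_neg hc]⟩)
      · by_cases hc : c₁ = c
        · rcases hkn x (hc ▸ h1) with h2 | h2
          · exact .inr (.inr ⟨c, by rwa [hq, if_pos rfl]⟩)
          · exact .inr (.inl ⟨c, by rwa [ha, if_pos rfl]⟩)
        · exact .inr (.inr ⟨c₁, by rwa [hq, if_neg hc]⟩)
  constructor
  · have := h.idle_queue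
    clear h hk hchild hsuf hright hup hlive hsup hstol
    grind
  · have := h.queue_suffix
    clear h hk hchild hright hup hlive hsup hstol
    grind
  · intro c₁ v hv w hw
    rw [ha] at hv
    rw [hq]
    split_ifs at hv ⊢ with hc
    · exact hright v hv w hw
    · rw [hd]
      exact (h.right_done c₁ v hv w hw).imp_left fun h => Set.mem_insert_of_mem _ h
  · intro c₁ v hv
    rw [ha] at hv
    rw [Finset.mem_insert, not_or]
    split_ifs at hv with hc
    · have h1 := (hdown v hv).1
      exact ⟨fun e => huq c (e ▸ h1), (h.queue_notMem c v h1).1⟩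
    · exact ⟨fun e => hc (hun c₁ (e ▸ .inl hv)), h.down_notMem c₁ v hv⟩
  · intro c₁ v hv
    rw [ha] at hv
    split_ifs at hv with hc
    · have h1 := hup v hv
      exact ⟨Finset.mem_insert_of_mem h1.1, h1.2.1, h1.2.2.1⟩
    · have h1 := h.up_mem c₁ v hv
      rw [hd]
      refine ⟨Finset.mem_insert_of_mem h1.1, ?_, fun b => Set.mem_insert_of_mem _ (h1.2.2 b)⟩
      rw [Set.mem_insert_iff, not_or]
      exact ⟨fun e => hc (hun c₁ (e ▸ .inr hv)), h1.2.1⟩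
  · intro c₁ x hx
    have h1 := hqm c₁ x hx
    have h2 := h.queue_notMem c₁ x h1
    refine ⟨?_, h2.2⟩
    rw [Finset.mem_insert, not_or]
    exact ⟨fun e => huq c₁ (e ▸ h1), h2.1⟩
  · exact fun x hx => h.known_isSome x ((hk x).1 hx)
  · exact fun b w hx => Finset.mem_insert_of_mem (h.known_parent b w ((hk _).1 hx))
  · intro b w hw hb
    rw [hk]
    rcases Finset.mem_insert.1 hw with rfl | hw
    · exact .inl (h.mem_of_done _ (hchild b hb))
    · exact h.known_child b w hw hb
  · exact fun x hx => (hk x).2 (h.known_of_stolen x hx)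
  · intro x hx
    rw [hd] at hx
    rcases hx with rfl | hx
    · exact Finset.mem_insert_self _ _
    · exact Finset.mem_insert_of_mem (h.mem_of_done x hx)
  · intro b x hx hb
    rw [hd] at hx ⊢
    rcases hx with rfl | hx
    · exact Set.mem_insert_of_mem _ (hchild b hb)
    · exact Set.mem_insert_of_mem _ (h.done_child b x hx hb)
  · have h1 := h.down_unique
    have h2 : ∀ c₁ w, a' = .down w → s.act c₁ ≠ .down w := fun c₁ w hw =>
      h.queue_down c c₁ w (hdown w hw).1
    clear h hk hchild hsuf hright hup hlive hsup hstol
    grind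
  · have h1 := h.up_unique
    clear h hk hchild hsuf hright hlive hsup hstol
    grind
  · exact fun c₁ c₂ x h1 h2 => h.queue_unique c₁ c₂ x (hqm _ _ h1) (hqm _ _ h2)
  · intro c₁ c₂ x h1 h2
    rw [ha] at h2
    split_ifs at h2 with hc
    · have h3 := hdown x h2
      by_cases hc' : c₁ = c
      · rw [hq, if_pos hc'] at h1
        exact h3.2 h1
      · exact hc' (h.queue_unique _ _ _ (hqm _ _ h1) h3.1)
    · exact h.queue_down c₁ c₂ x (hqm _ _ h1) h2
  · intro w hw hwd
    have hwu : w ≠ u := by rintro rfl; simp [hd] at hwd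
    have hw' : w ∈ D := (Finset.mem_insert.1 hw).resolve_left hwu
    obtain ⟨c₁, v, h1, h2⟩ := h.live w hw' fun hw => hwd (hd ▸ Set.mem_insert_of_mem _ hw)
    by_cases hc : c₁ = c
    · obtain rfl : v = u := by
        rw [hc] at h1
        unfold Activity.At at h1 hat
        clear h
        grind
      exact hlive w hw' hwd h2
    · exact ⟨c₁, v, by rwa [ha, if_neg hc], h2⟩
  · intro c₁ v hv
    rw [ha] at hv
    split_ifs at hv with hc
    · rw [hc]
      exact (h.seg_queue c v (hdown v hv).1).trans (List.tail_suffix v)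
    · exact h.seg_down c₁ v hv
  · have := h.seg_up
    clear h hk hchild hsuf hright hlive hup hstol
    grind
  · exact fun c₁ x hx => h.seg_queue c₁ x (hqm _ _ hx)
  · intro c₁ h1
    rw [ha] at h1
    split_ifs at h1 with hc
    · rw [hc]
      exact h.seg_stolen c (by rintro h2; simp [h2, Activity.At] at hat)
    · exact h.seg_stolen c₁ h1
  · rintro w hw
    have h1 := h.stolen w
    have : true :: w ∈ D ∨ (∃ c, s.act c = .down (true :: w)) ∨ a' = .down (true :: w) := by
      rcases hw with hw | ⟨c₁, hw⟩
      · rcases Finset.mem_insert.1 hw with hw | hw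
        · rcases hat with h2 | h2
          · exact .inr (.inl ⟨c, hw ▸ h2⟩)
          · exact .inl (hw ▸ (h.up_mem c u h2).1)
        · exact .inl hw
      · rw [ha] at hw
        split_ifs at hw with hc
        · exact .inr (.inr hw)
        · exact .inr (.inl ⟨c₁, hw⟩)
    rcases this with h2 | h2 | h2
    · exact (h1 (.inl h2)).imp_right fun h => hd ▸ Set.mem_insert_of_mem _ h
    · exact (h1 (.inr h2)).imp_right fun h => hd ▸ Set.mem_insert_of_mem _ h
    · exact .inr (hstol w h2)

/-- The three ways in which a core goes on after it has completed a task `b :: v`. -/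
theorem finish_cases (h : Inv T s D Z seg) {c : Fin p} {b : Bool} {v : Node}
    (hat : (s.act c).At (b :: v)) (t : List Access) :
    (∃ q, b = false ∧ s.queue c = q ++ [true :: v] ∧ q <:+ lefts v ∧
      (s.finish c t (b :: v)).act = Function.update s.act c (.down (true :: v)) ∧
      (s.finish c t (b :: v)).queue = Function.update s.queue c q) ∨
    ((!b) :: v ∈ s.done ∧ s.queue c <:+ lefts v ∧
      (s.finish c t (b :: v)).act = Function.update s.act c (.up v) ∧
      (s.finish c t (b :: v)).queue = s.queue) ∨
    ((!b) :: v ∉ s.done ∧ s.queue c = [] ∧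
      (s.finish c t (b :: v)).act = Function.update s.act c .idle ∧
      (s.finish c t (b :: v)).queue = s.queue) := by
  have hsf := h.queue_suffix c _ hat
  by_cases hl : (s.queue c).getLast? = some ((!b) :: v)
  · left
    obtain ⟨q, hq⟩ := List.getLast?_eq_some_iff.1 hl
    obtain ⟨w, hw, -⟩ := mem_lefts.1 (hsf.subset (a := (!b) :: v) (by simp [hq]))
    obtain rfl : b = false := by simpa using (List.cons.inj hw).1
    refine ⟨q, rfl, hq, ?_, ?_, ?_⟩
    · rcases suffix_lefts_false hsf with h1 | ⟨q', h1, h2⟩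
      · simp [hq] at h1
      · rw [hq] at h1
        rw [(List.append_inj' h1 rfl).1]
        exact h2
    · simp only [State.finish, if_pos hl]; rfl
    · simp only [State.finish, if_pos hl]
      rw [hq, List.dropLast_concat]
  · right
    have h1 : (s.finish c t (b :: v)).queue = s.queue := by
      simp only [State.finish, if_neg hl, Function.update_eq_self]
    by_cases hd : (!b) :: v ∈ s.done
    · left
      refine ⟨hd, ?_, by simp only [State.finish, if_neg hl, if_pos hd], h1⟩
      cases b
      · rcases suffix_lefts_false hsf with h2 | ⟨q', h2, -⟩
        · rw [h2]; exact List.nil_suffix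
        · simp [h2] at hl
      · exact hsf
    · right
      refine ⟨hd, ?_, by simp only [State.finish, if_neg hl, if_neg hd], h1⟩
      cases b
      · rcases suffix_lefts_false hsf with h2 | ⟨q', h2, -⟩
        · exact h2
        · simp [h2] at hl
      -- With the left sibling unfinished, all queued tasks would be deeper than this right child; a
      -- queue never holds tasks deeper than the node of its core, so it is empty.
      · rcases h.right_done c _ hat v List.suffix_rfl with h2 | h2
        · exact absurd h2 hd
        · by_contra hne
          obtain ⟨x, hx⟩ := List.exists_mem_of_ne_nil _ hne
          have h3 := h2 x hx
          have h4 := length_le_of_mem_lefts (hsf.subset hx)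
          simp at h4
          omega

theorem finish_done (s : State p) (c : Fin p) (t : List Access) (u : Node) :
    (s.finish c t u).done = insert u s.done := by cases u <;> rfl

theorem finish_trace (s : State p) (c : Fin p) (t : List Access) (u : Node) :
    (s.finish c t u).trace = Function.update s.trace c (s.trace c ++ t) := by cases u <;> rfl

theorem finish (h : Inv T s D Z seg) {c : Fin p} {u : Node} (t : List Access)
    (hat : (s.act c).At u) (hchild : ∀ b, (T.task (b :: u)).isSome → b :: u ∈ s.done) :
    Inv T (s.finish c t u) (insert u D) Z seg := by
  have hd := finish_done s c t u
  have hsf := h.queue_suffix c _ hat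
  have hdD : ∀ x ∈ s.done, x ∈ D := h.mem_of_done
  rcases u with _ | ⟨b, v⟩
  · have hqe : s.queue c = [] := List.suffix_nil.1 hsf
    refine h.complete (a' := .idle) (q' := []) hat hchild ?_ ?_ hd ?_ ?_ ?_ ?_ ?_ ?_ ?_ ?_ ?_ ?_
    · simp [State.finish, Function.update_apply]
    · intro c₁
      simp only [State.finish]
      split_ifs with hc
      · rw [hc, hqe]
      · rfl
    · simp
    · simp [hqe]
    · simp
    · simp
    · simp
    · simp
    · simp
    · intro w _ hw h2
      rw [List.suffix_nil.1 h2, hd] at hw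
      simp at hw
    · simp
    · simp
  have hvD : v ∈ D := h.known_parent b v (h.known_at hat)
  have hvd : v ∉ s.done := fun hv =>
    h.notMem_done hat (h.done_child b v hv (h.known_isSome _ (h.known_at hat)))
  have hwv : ∀ w, w ∉ (s.finish c t (b :: v)).done → w <:+ b :: v → w <:+ v := by
    intro w hw hwu
    rcases List.suffix_cons_iff.1 hwu with rfl | h
    · simp [hd] at hw
    · exact h
  rcases h.finish_cases hat t with ⟨q, rfl, h1, h2, h3, h4⟩ | ⟨h1, h2, h3, h4⟩ | ⟨h1, h2, h3, h4⟩
  · have hnd : true :: v ∉ q := fun hx => by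
      have := length_le_of_mem_lefts (h2.subset hx)
      simp at this
    refine h.complete (a' := .down (true :: v)) (q' := q) hat hchild
      (by simp [h3, Function.update_apply]) (by simp [h4, Function.update_apply]) hd
      ?_ ?_ ?_ ?_ ?_ ?_ ?_ ?_ ?_ ?_
    · simp +contextual [h1]
    · intro x hx
      rw [h1] at hx
      simp at hx
      rcases hx with hx | rfl
      · exact .inl hx
      · exact .inr rfl
    · simp
    · rintro w (hw | hw)
      · obtain rfl : true :: v = w := by simpa using hw
        exact h2
      · simp at hw
    · rintro w (hw | hw) x hx
      · obtain rfl : true :: v = w := by simpa using hw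
        rw [hd]
        rcases List.suffix_cons_iff.1 hx with hx | hx
        · left; rw [(List.cons.inj hx).2]; exact Set.mem_insert _ _
        · rcases h.right_done c _ hat x (hx.trans (List.suffix_cons _ _)) with h5 | h5
          · exact .inl (Set.mem_insert_of_mem _ h5)
          · exact .inr fun y hy => h5 y (by simp [h1, hy])
      · simp at hw
    · intro w hw
      obtain rfl : true :: v = w := by simpa using hw
      exact ⟨by simp [h1], hnd⟩
    · simp
    · intro w _ hw hwu
      exact ⟨c, true :: v, .inl (by simp [h3]), (hwv w hw hwu).trans (List.suffix_cons _ _)⟩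
    · simp
    · intro w hw
      obtain rfl : v = w := by simpa using hw
      rw [hd]; exact Set.mem_insert _ _
  · refine h.complete (a' := .up v) (q' := s.queue c) hat hchild
      (by simp [h3, Function.update_apply])
      (fun c₁ => by rw [h4]; split_ifs with hc; exacts [hc ▸ rfl, rfl]) hd
      ?_ ?_ ?_ ?_ ?_ ?_ ?_ ?_ ?_ ?_
    · simp
    · simp +contextual
    · simp
    · rintro w (hw | hw)
      · simp at hw
      · obtain rfl : v = w := by simpa using hw
        exact h2
    · rintro w (hw | hw) x hx
      · simp at hw
      · obtain rfl : v = w := by simpa using hw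
        rw [hd]
        exact (h.right_done c _ hat x (hx.trans (List.suffix_cons _ _))).imp_left
          fun h5 => Set.mem_insert_of_mem _ h5
    · simp
    · intro w hw
      obtain rfl : v = w := by simpa using hw
      rw [hd]
      refine ⟨hvD, ?_, ?_, ?_⟩
      · rw [Set.mem_insert_iff, not_or]
        exact ⟨fun e => by simpa using congrArg List.length e, hvd⟩
      · intro b'
        by_cases hb : b' = b
        · rw [hb]; exact Set.mem_insert _ _
        · obtain rfl : b' = !b := Bool.eq_not_of_ne hb
          exact Set.mem_insert_of_mem _ h1
      · intro c₁ hc₁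
        exact h.notMem_done hat ((h.up_mem c₁ v hc₁).2.2 b)
    · intro w _ hw hwu
      exact ⟨c, v, .inr (by simp [h3]), hwv w hw hwu⟩
    · intro w hw
      obtain rfl : v = w := by simpa using hw
      have : b :: v <:+ seg c ∨ seg c <:+ b :: v := by
        rcases hat with h5 | h5
        · exact .inr (h.seg_down c _ h5)
        · exact h.seg_up c _ h5
      rcases this with h5 | h5
      · exact .inl ((List.suffix_cons _ _).trans h5)
      · rcases List.suffix_cons_iff.1 h5 with h6 | h6
        · rw [h6]; exact .inl (List.suffix_cons _ _)
        · exact .inr h6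
    · simp
  · refine h.complete (a' := .idle) (q' := s.queue c) hat hchild
      (by simp [h3, Function.update_apply])
      (fun c₁ => by rw [h4]; split_ifs with hc; exacts [hc ▸ rfl, rfl]) hd
      ?_ ?_ ?_ ?_ ?_ ?_ ?_ ?_ ?_ ?_
    · simp
    · simp +contextual
    · simp [h2]
    · simp [Activity.At]
    · simp [Activity.At]
    · simp
    · simp
    · intro w _ hw hwu
      have hwv' := hwv w hw hwu
      -- The core becomes idle, so another core has to be at work below `v`. The unfinished sibling
      -- supplies one: it has been started, or it waits on the queue of a core inside `v`.
      have hsib := h.known_child (!b) v hvD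
        (BPTree.task_isSome_sibling _ (h.known_isSome _ (h.known_at hat)))
      have hne : ∀ c₁ x, (s.act c₁).At x → c₁ = c → x = b :: v := by
        rintro c₁ x hx rfl
        unfold Activity.At at hx hat
        clear h
        grind
      obtain ⟨c₁, x, h5, h6, h7⟩ : ∃ c₁ x, (s.act c₁).At x ∧ c₁ ≠ c ∧ v <:+ x := by
        rcases hsib with h5 | ⟨c₁, h5⟩ | ⟨c₁, h5⟩
        · obtain ⟨c₁, x, h6, h7⟩ := h.live _ h5 h1
          refine ⟨c₁, x, h6, fun e => ?_, (List.suffix_cons _ _).trans h7⟩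
          rw [hne c₁ x h6 e] at h7
          simpa using cons_suffix_cons_iff.1 h7
        · refine ⟨c₁, _, .inl h5, fun e => ?_, List.suffix_cons _ _⟩
          simpa using hne c₁ _ (.inl h5) e
        · obtain ⟨x, w', h6, h7, h8⟩ := h.queue_mem h5
          refine ⟨c₁, x, h6, fun e => ?_, ?_⟩
          · rw [e, h2] at h5; simp at h5
          · rw [(List.cons.inj h7).2]; exact (List.suffix_cons _ _).trans h8
      refine ⟨c₁, x, ?_, hwv'.trans h7⟩
      rw [h3, Function.update_of_ne h6]
      exact h5
    · simp
    · simp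

end Inv

end

/-! ### Executions with bookkeeping -/

/-- Bookkeeping for an execution: the nodes whose downpass code has been executed, the stolen
tasks, the nodes whose up-pass code has been executed by a core that had started below them, and
the task with which each core started most recently. -/
structure Ghost (p : ℕ) where
  exec : Finset Node
  stolen : Finset Node
  climbed : Finset Node
  seg : Fin p → Node

/-- The steps of an execution, with bookkeeping. -/
inductive GStep {p : ℕ} (T : BPTree) (s : State p) (g : Ghost p) : State p → Ghost p → Prop where
  | fork (c : Fin p) (u : Node) (L : Finset ℕ) (head tail : List Access) (l r : BPTree)
      (hact : s.act c = .down u) (hu : T.task u = some (.fork L head tail l r)) :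
      GStep T s g
        { act := Function.update s.act c (.down (false :: u))
          queue := Function.update s.queue c (s.queue c ++ [true :: u])
          trace := Function.update s.trace c (s.trace c ++ head)
          done := s.done }
        { g with exec := insert u g.exec }
  | leaf (c : Fin p) (u : Node) (L : Finset ℕ) (code : List Access)
      (hact : s.act c = .down u) (hu : T.task u = some (.leaf L code)) :
      GStep T s g (s.finish c code u) { g with exec := insert u g.exec }
  | up (c : Fin p) (u : Node) (L : Finset ℕ) (head tail : List Access) (l r : BPTree)
      (hact : s.act c = .up u) (hu : T.task u = some (.fork L head tail l r)) :
      GStep T s g (s.finish c tail u)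
        { g with climbed := if g.seg c <:+ u then g.climbed else insert u g.climbed }
  | steal (c c' : Fin p) (v : Node) (q : List Node)
      (hact : s.act c = .idle) (hq : s.queue c' = v :: q) (hround : s.IsRound T v.length) :
      GStep T s g
        { act := Function.update s.act c (.down v)
          queue := Function.update s.queue c' q
          trace := s.trace
          done := s.done }
        { g with stolen := insert v g.stolen, seg := Function.update g.seg c v }

/-- `GReach T c₀ s g`: the state `s` can be reached, with bookkeeping `g`. -/
inductive GReach {p : ℕ} (T : BPTree) (c₀ : Fin p) : State p → Ghost p → Prop where
  | init : GReach T c₀ (State.init c₀) ⟨∅, ∅, ∅, fun _ => []⟩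
  | step {s s' : State p} {g g' : Ghost p} (h : GReach T c₀ s g) (hs : GStep T s g s' g') :
      GReach T c₀ s' g'

variable {p : ℕ} {T : BPTree} {c₀ : Fin p} {s s' : State p} {g g' : Ghost p}

theorem exists_gReach (h : Relation.ReflTransGen (Step T) (State.init c₀) s) :
    ∃ g, GReach T c₀ s g := by
  induction h with
  | refl => exact ⟨_, .init⟩
  | tail _ hs ih =>
    obtain ⟨g, hg⟩ := ih
    cases hs with
    | fork c u L head tail l r hact hu => exact ⟨_, hg.step (.fork c u L head tail l r hact hu)⟩
    | leaf c u L code hact hu => exact ⟨_, hg.step (.leaf c u L code hact hu)⟩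
    | up c u L head tail l r hact hu => exact ⟨_, hg.step (.up c u L head tail l r hact hu)⟩
    | steal c c' v q hact hq hround => exact ⟨_, hg.step (.steal c c' v q hact hq hround)⟩

/-- The invariants, in terms of the bookkeeping. -/
abbrev GInv (T : BPTree) (s : State p) (g : Ghost p) : Prop := Inv T s g.exec g.stolen g.seg

theorem GStep.inv (hs : GStep T s g s' g') (h : GInv T s g) : GInv T s' g' := by
  cases hs with
  | fork c u L head tail l r hact hu =>
    exact h.fork hact hu (fun _ => Function.update_apply ..) (fun _ => Function.update_apply ..) rfl
  | leaf c u L code hact hu =>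
    exact h.finish code (.inl hact) fun b hb => by simp [BPTree.task_cons_leaf hu] at hb
  | up c u L head tail l r hact hu =>
    obtain ⟨h1, -, h2⟩ := h.up_mem c u hact
    have := h.finish tail (.inr hact) fun b _ => h2 b
    rwa [Finset.insert_eq_of_mem h1] at this
  | steal c c' v q hact hq hround =>
    exact h.steal hact hq (fun _ => Function.update_apply ..) (fun _ => Function.update_apply ..) rfl

theorem GReach.inv (h : GReach T c₀ s g) : GInv T s g := by
  induction h with
  | init => exact Inv.init (by simp [BPTree.task]) c₀
  | step _ hs ih => exact hs.inv ih

/-! ### The numbers of steals and of climbs at each depth -/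

/-- The core `c` has a task of depth `d` on its queue, or is about to put one on its empty queue. -/
def Provides (T : BPTree) (s : State p) (c : Fin p) (d : ℕ) : Prop :=
  (∃ v ∈ s.queue c, v.length = d) ∨
    (s.queue c = [] ∧ ∃ u L head tail l r, s.act c = .down u ∧
      T.task u = some (.fork L head tail l r) ∧ d = u.length + 1)

theorem available_of_mem {c : Fin p} {x : Node} (h : x ∈ s.queue c) : s.Available T x.length :=
  ⟨c, .inl ⟨x, h, rfl⟩⟩

/-- A core at an inner node provides a task that is at most one level deeper. -/
theorem exists_available_of_fork (h : GInv T s g) {c : Fin p} {u : Node} {L : Finset ℕ}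
    {head tail : List Access} {l r : BPTree} (hact : s.act c = .down u)
    (hu : T.task u = some (.fork L head tail l r)) :
    (s.queue c = [] ∧ s.Available T (u.length + 1)) ∨ ∃ d ≤ u.length, s.Available T d := by
  rcases hq : s.queue c with _ | ⟨x, q⟩
  · exact .inl ⟨rfl, c, .inr ⟨hq, u, L, head, tail, l, r, hact, hu, rfl⟩⟩
  · have hx : x ∈ s.queue c := by simp [hq]
    exact .inr ⟨x.length, length_le_of_mem_lefts ((h.queue_suffix c u (.inl hact)).subset hx),
      available_of_mem hx⟩

theorem Inv.provides_finish {D Z : Finset Node} {seg : Fin p → Node} (h : Inv T s D Z seg)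
    {c c₁ : Fin p} {u : Node} (t : List Access) (hat : (s.act c).At u) {d : ℕ}
    (hp : Provides T (s.finish c t u) c₁ d) :
    Provides T s c₁ d ∨ ∃ d₀ < d, s.Available T d₀ := by
  rcases u with _ | ⟨b, v⟩
  · left
    by_cases hc : c₁ = c
    · simp [Provides, State.finish, hc, List.suffix_nil.1 (h.queue_suffix c _ hat)] at hp
    · simpa [Provides, State.finish, Function.update_of_ne hc] using hp
  rcases h.finish_cases hat t with ⟨q, rfl, h1, h2, h3, h4⟩ | ⟨h1, h2, h3, h4⟩ | ⟨h1, h2, h3, h4⟩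
  · by_cases hc : c₁ = c
    · subst hc
      simp only [Provides, h3, h4, Function.update_self] at hp
      rcases hp with ⟨x, hx, rfl⟩ | ⟨-, w, _, _, _, _, _, h5, -, rfl⟩
      · exact .inl (.inl ⟨x, by simp [h1, hx], rfl⟩)
      · right
        obtain rfl : true :: v = w := by simpa using h5
        exact ⟨_, Nat.lt_succ_self _, available_of_mem (c := c₁) (by simp [h1])⟩
    · left
      simpa only [Provides, h3, h4, Function.update_of_ne hc] using hp
  all_goals
    left
    simp only [Provides, h3, h4] at hp
    by_cases hc : c₁ = c
    · subst hc
      simp only [Function.update_self] at hp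
      rcases hp with h5 | ⟨-, w, _, _, _, _, _, h5, -⟩
      · exact .inl h5
      · simp at h5
    · simpa only [Provides, Function.update_of_ne hc] using hp

/-- A task of some depth becomes available only while there is a task of smaller depth. -/
theorem GStep.provides (hs : GStep T s g s' g') (h : GInv T s g) {c₁ : Fin p} {d : ℕ}
    (hp : Provides T s' c₁ d) : Provides T s c₁ d ∨ ∃ d₀ < d, s.Available T d₀ := by
  cases hs with
  | fork c u L head tail l r hact hu =>
    by_cases hc : c₁ = c
    · subst hc
      simp only [Provides, Function.update_self] at hp
      rcases hp with ⟨x, hx, rfl⟩ | ⟨hx, -⟩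
      · rw [List.mem_append, List.mem_singleton] at hx
        rcases hx with hx | rfl
        · exact .inl (.inl ⟨x, hx, rfl⟩)
        · rcases exists_available_of_fork h hact hu with ⟨h1, -⟩ | ⟨d, h1, h2⟩
          · exact .inl (.inr ⟨h1, u, L, head, tail, l, r, hact, hu, rfl⟩)
          · exact .inr ⟨d, by simp; omega, h2⟩
      · simp at hx
    · left
      simpa only [Provides, Function.update_of_ne hc] using hp
  | leaf c u L code hact hu => exact h.provides_finish code (.inl hact) hp
  | up c u L head tail l r hact hu => exact h.provides_finish tail (.inr hact) hp
  | steal c c' v q hact hq hround =>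
    have hav : s.Available T v.length := hround.1
    have hvc : v ∈ s.queue c' := by simp [hq]
    have hcc : c ≠ c' := by rintro rfl; simp [h.idle_queue c hact] at hvc
    by_cases hc : c₁ = c
    · subst hc
      simp only [Provides, Function.update_self, Function.update_of_ne hcc,
        h.idle_queue c₁ hact] at hp
      rcases hp with ⟨x, hx, -⟩ | ⟨-, w, _, _, _, _, _, h5, -, rfl⟩
      · simp at hx
      · obtain rfl : v = w := by simpa using h5
        exact .inr ⟨_, Nat.lt_succ_self _, hav⟩
    · by_cases hc' : c₁ = c'
      · subst hc'
        simp only [Provides, Function.update_self, Function.update_of_ne hc] at hp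
        rcases hp with ⟨x, hx, rfl⟩ | ⟨-, w, _, _, _, _, _, h5, -, rfl⟩
        · exact .inl (.inl ⟨x, by simp [hq, hx], rfl⟩)
        · exact .inr ⟨_, Nat.lt_succ_of_le (length_le_of_mem_lefts
            ((h.queue_suffix c₁ w (.inl h5)).subset hvc)), hav⟩
      · left
        simpa only [Provides, Function.update_of_ne hc, Function.update_of_ne hc'] using hp

/-- Rounds only move downwards in the tree, since a new offer requires a shallower one at the same
moment. -/
theorem GStep.le_of_available (hs : GStep T s g s' g') (h : GInv T s g) {d : ℕ}
    (hd : ∀ d', s.Available T d' → d ≤ d') : ∀ d', s'.Available T d' → d ≤ d' := by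
  rintro d' ⟨c, hc⟩
  rcases hs.provides h hc with h1 | ⟨d₀, h1, h2⟩
  · exact hd d' ⟨c, h1⟩
  · exact (hd d₀ h2).trans h1.le

theorem GStep.provides_of_le (hs : GStep T s g s' g') (h : GInv T s g) {d : ℕ}
    (hd : ∀ d', s.Available T d' → d ≤ d') {c : Fin p} (hc : Provides T s' c d) :
    Provides T s c d := by
  rcases hs.provides h hc with h1 | ⟨d₀, h1, h2⟩
  · exact h1
  · exact absurd (hd d₀ h2) (by omega)

/-- A steal of a task at some depth ends the provision of such a task by the victim. -/
theorem GStep.stolen_or (hs : GStep T s g s' g') (h : GInv T s g) :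
    g'.stolen = g.stolen ∨ ∃ c v, s.IsRound T v.length ∧ g'.stolen = insert v g.stolen ∧
      Provides T s c v.length ∧ ¬ Provides T s' c v.length := by
  cases hs with
  | steal c c' v q hact hq hround =>
    right
    have hvc : v ∈ s.queue c' := by simp [hq]
    have hcc : c ≠ c' := by rintro rfl; simp [h.idle_queue c hact] at hvc
    refine ⟨c', v, hround, rfl, .inl ⟨v, hvc, rfl⟩, ?_⟩
    rintro (⟨x, hx, h2⟩ | ⟨-, w, _, _, _, _, _, h2, -, h3⟩)
    · simp only [Function.update_self] at hx
      have := h.queue_pairwise c'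
      rw [hq, List.pairwise_cons] at this
      have := this.1 x hx
      omega
    · simp only [Function.update_of_ne hcc.symm] at h2
      have := length_le_of_mem_lefts ((h.queue_suffix c' w (.inl h2)).subset hvc)
      omega
  | _ => exact .inl rfl

open Classical in
-- From the first steal at depth `d` on, `d` is a lower bound for the depths on offer. The set of
-- cores offering depth `d` then only shrinks, and each steal at this depth removes one of them. As
-- at most `p` cores offer at the beginning, steals plus remaining offers stay at most `p`.
theorem GReach.steals_or (h : GReach T c₀ s g) (d : ℕ) :
    (g.stolen.filter (·.length = d)).card = 0 ∨
      ((g.stolen.filter (·.length = d)).card +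
        (Finset.univ.filter fun c => Provides T s c d).card ≤ p ∧
        ∀ d', s.Available T d' → d ≤ d') := by
  induction h with
  | init => exact .inl (by simp)
  | @step s s' g g' hr hs ih =>
    have hI := hr.inv
    have key : (∀ d', s.Available T d' → d ≤ d') →
        (Finset.univ.filter fun c => Provides T s' c d) ⊆
          Finset.univ.filter fun c => Provides T s c d := fun hd c hc => by
      simp only [Finset.mem_filter, Finset.mem_univ, true_and] at hc ⊢
      exact hs.provides_of_le hI hd hc
    have gen : g'.stolen.filter (·.length = d) = g.stolen.filter (·.length = d) →
        (g'.stolen.filter (·.length = d)).card = 0 ∨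
          ((g'.stolen.filter (·.length = d)).card +
            (Finset.univ.filter fun c => Provides T s' c d).card ≤ p ∧
            ∀ d', s'.Available T d' → d ≤ d') := by
      intro he
      rw [he]
      refine ih.imp_right fun ⟨h1, h2⟩ => ⟨?_, hs.le_of_available hI h2⟩
      have := Finset.card_le_card (key h2)
      omega
    rcases hs.stolen_or hI with he | ⟨c, v, hround, he, h1, h2⟩
    · exact gen (by rw [he])
    · by_cases hv : v.length = d
      · right
        subst hv
        refine ⟨?_, hs.le_of_available hI hround.2⟩
        have h3 : (Finset.univ.filter fun c => Provides T s' c v.length).card <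
            (Finset.univ.filter fun c => Provides T s c v.length).card :=
          Finset.card_lt_card ((Finset.ssubset_iff_of_subset (key hround.2)).2
            ⟨c, by simpa using h1, by simpa using h2⟩)
        have h4 : (g'.stolen.filter (·.length = v.length)).card ≤
            (g.stolen.filter (·.length = v.length)).card + 1 := by
          rw [he, Finset.filter_insert, if_pos rfl]
          exact Finset.card_insert_le _ _
        have h5 : (Finset.univ.filter fun c => Provides T s c v.length).card ≤ p :=
          (Finset.card_le_univ _).trans (by simp)
        rcases ih with ih | ih <;> omega
      · exact gen (by rw [he, Finset.filter_insert, if_neg hv])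

theorem GReach.card_stolen_le (h : GReach T c₀ s g) (d : ℕ) :
    (g.stolen.filter (·.length = d)).card ≤ p := by
  rcases h.steals_or d with h | h <;> omega

/-- A node is started only while a task at most as deep is on offer. Hence a level is closed to new
starts once the rounds have passed it. -/
theorem GStep.down_or (hs : GStep T s g s' g') (h : GInv T s g) {c₁ : Fin p} {w : Node}
    (hw : s'.act c₁ = .down w) :
    s.act c₁ = .down w ∨ ∃ d ≤ w.length, s.Available T d := by
  have fin : ∀ (c : Fin p) u t, (s.act c).At u → (s.finish c t u).act c₁ = .down w →
      s.act c₁ = .down w ∨ ∃ d ≤ w.length, s.Available T d := by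
    intro c u t hat hw
    by_cases hc : c₁ = c
    · subst hc
      right
      rcases u with _ | ⟨b, v⟩
      · simp [State.finish] at hw
      rcases h.finish_cases hat t with ⟨q, rfl, h1, h2, h3, h4⟩ | ⟨h1, h2, h3, h4⟩ |
          ⟨h1, h2, h3, h4⟩ <;> simp only [h3, Function.update_self] at hw
      · obtain rfl : true :: v = w := by simpa using hw
        exact ⟨_, le_rfl, available_of_mem (c := c₁) (by simp [h1])⟩
      · simp at hw
      · simp at hw
    · left
      cases u <;> simpa [State.finish, Function.update_of_ne hc] using hw
  cases hs with
  | fork c u L head tail l r hact hu =>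
    by_cases hc : c₁ = c
    · subst hc
      obtain rfl : false :: u = w := by simpa using hw
      rcases exists_available_of_fork h hact hu with ⟨-, h1⟩ | ⟨d, h1, h2⟩
      · exact .inr ⟨_, le_rfl, h1⟩
      · exact .inr ⟨d, by simp; omega, h2⟩
    · left
      simpa [Function.update_of_ne hc] using hw
  | leaf c u L code hact hu => exact fin c u code (.inl hact) hw
  | up c u L head tail l r hact hu => exact fin c u tail (.inr hact) hw
  | steal c c' v q hact hq hround =>
    by_cases hc : c₁ = c
    · subst hc
      obtain rfl : v = w := by simpa using hw
      exact .inr ⟨_, le_rfl, hround.1⟩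
    · left
      simpa [Function.update_of_ne hc] using hw

theorem GStep.exec_or (hs : GStep T s g s' g') {w : Node} (hw : w ∈ g'.exec) :
    w ∈ g.exec ∨ ∃ c, s.act c = .down w := by
  cases hs with
  | fork c u L head tail l r hact hu =>
    rcases Finset.mem_insert.1 hw with rfl | hw
    exacts [.inr ⟨c, hact⟩, .inl hw]
  | leaf c u L code hact hu =>
    rcases Finset.mem_insert.1 hw with rfl | hw
    exacts [.inr ⟨c, hact⟩, .inl hw]
  | up => exact .inl hw
  | steal => exact .inl hw

theorem GStep.done_subset (hs : GStep T s g s' g') : s.done ⊆ s'.done := by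
  cases hs with
  | fork => exact subset_rfl
  | leaf c u L code hact hu => rw [Inv.finish_done]; exact Set.subset_insert _ _
  | up c u L head tail l r hact hu => rw [Inv.finish_done]; exact Set.subset_insert _ _
  | steal => exact subset_rfl

theorem GStep.stolen_subset (hs : GStep T s g s' g') : g.stolen ⊆ g'.stolen := by
  cases hs with
  | steal => exact Finset.subset_insert _ _
  | _ => exact subset_rfl

theorem GStep.climbed_or (hs : GStep T s g s' g') {w : Node} (hw : w ∈ g'.climbed) :
    w ∈ g.climbed ∨ ∃ c, s.act c = .up w ∧ ¬ g.seg c <:+ w := by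
  cases hs with
  | up c u L head tail l r hact hu =>
    simp only at hw
    split_ifs at hw with h
    · exact .inl hw
    · rcases Finset.mem_insert.1 hw with rfl | hw
      exacts [.inr ⟨c, hact, h⟩, .inl hw]
  | _ => exact .inl hw

/-- The task on which a core works, at depth `i`. -/
def State.ancestor (s : State p) (i : ℕ) (c : Fin p) : Node :=
  match s.act c with
  | .idle => []
  | .down u => u.drop (u.length - i)
  | .up u => u.drop (u.length - i)

theorem ancestor_eq {c : Fin p} {u w : Node} (hat : (s.act c).At u) (hw : w <:+ u) :
    s.ancestor w.length c = w := by
  rw [List.suffix_iff_eq_drop] at hw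
  rcases hat with h | h <;> simp only [State.ancestor, h] <;> exact hw.symm

/-- As long as no task of depth `i + 2` or more has been stolen, a core that climbs to depth `i` had
started at a child of that node, and this child was stolen. When the first deeper steal occurs,
nothing shallower than `i + 2` is on offer: from then on no node of depth `i` is started, and each
unfinished one has a core below it. These nodes are collected in `A`. -/
theorem GReach.climbs_or (h : GReach T c₀ s g) (i : ℕ) :
    ((∀ x ∈ g.stolen, x.length < i + 2) ∧
      ∀ w ∈ g.climbed, w.length = i → ∃ b, b :: w ∈ g.stolen) ∨
    ((∀ d, s.Available T d → i + 2 ≤ d) ∧ ∃ A : Finset Node, A.card ≤ p ∧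
      (∀ w, w.length = i → w ∉ s.done → (w ∈ g.exec ∨ ∃ c, s.act c = .down w) → w ∈ A) ∧
      ∀ w ∈ g.climbed, w.length = i → w ∈ A ∨ ∃ b, b :: w ∈ g.stolen) := by
  induction h with
  | init => exact .inl ⟨by simp, by simp⟩
  | @step s s' g g' hr hs ih =>
    have hI := hr.inv
    have hst := hs.stolen_subset
    rcases ih with ⟨h1, h2⟩ | ⟨h1, A, h2, h3, h4⟩
    · have hcl : ∀ w ∈ g'.climbed, w.length = i → ∃ b, b :: w ∈ g.stolen := by
        intro w hw hwi
        rcases hs.climbed_or hw with hw | ⟨c, hact, hseg⟩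
        · exact h2 w hw hwi
        · have h5 := (hI.seg_up c w hact).resolve_right hseg
          rcases hI.seg_stolen c (by simp [hact]) with h6 | h6
          · exact absurd (h6 ▸ List.nil_suffix) hseg
          · rcases suffix_cases h5 with h7 | ⟨b, h7⟩
            · exact absurd (h7 ▸ List.suffix_rfl) hseg
            · refine ⟨b, ?_⟩
              rwa [h7.eq_of_length_le]
              have := h1 _ h6
              simp; omega
      by_cases hall : ∀ x ∈ g'.stolen, x.length < i + 2
      · exact .inl ⟨hall, fun w hw hwi => (hcl w hw hwi).imp fun b hb => hst hb⟩
      · right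
        rcases hs.stolen_or hI with he | ⟨c, v, hround, he, -⟩
        · exact absurd (he ▸ h1) hall
        · have hv : i + 2 ≤ v.length := by
            by_contra hv
            refine hall fun x hx => ?_
            rcases Finset.mem_insert.1 (he ▸ hx) with rfl | hx
            · omega
            · exact h1 x hx
          have hav : ∀ d, s.Available T d → i + 2 ≤ d := fun d hd => hv.trans (hround.2 d hd)
          -- `A` is fixed at this moment, with one ancestor of depth `i` per core; the values for
          -- idle or shallower cores do no harm.
          refine ⟨hs.le_of_available hI hav, Finset.univ.image (s.ancestor i), ?_, ?_, ?_⟩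
          · exact Finset.card_image_le.trans (by simp)
          · intro w hwi hwd hw
            rw [Finset.mem_image]
            have hwd' : w ∉ s.done := fun h => hwd (hs.done_subset h)
            have hdown : ∀ c₁, s'.act c₁ = .down w → s.act c₁ = .down w := by
              intro c₁ hw
              rcases hs.down_or hI hw with h5 | ⟨d, h5, h6⟩
              · exact h5
              · have := hav d h6
                omega
            have : ∃ c u, (s.act c).At u ∧ w <:+ u := by
              rcases hw with hw | ⟨c₁, hw⟩
              · rcases hs.exec_or hw with hw | ⟨c₁, hw⟩
                · exact hI.live w hw hwd'
                · exact ⟨c₁, w, .inl hw, List.suffix_rfl⟩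
              · exact ⟨c₁, w, .inl (hdown c₁ hw), List.suffix_rfl⟩
            obtain ⟨c₁, u, h5, h6⟩ := this
            exact ⟨c₁, Finset.mem_univ _, hwi ▸ ancestor_eq h5 h6⟩
          · intro w hw hwi
            exact .inr ((hcl w hw hwi).imp fun b hb => hst hb)
    · right
      refine ⟨hs.le_of_available hI h1, A, h2, ?_, ?_⟩
      · intro w hwi hwd hw
        refine h3 w hwi (fun h => hwd (hs.done_subset h)) ?_
        rcases hw with hw | ⟨c, hw⟩
        · exact hs.exec_or hw
        · rcases hs.down_or hI hw with h5 | ⟨d, h5, h6⟩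
          · exact .inr ⟨c, h5⟩
          · have := h1 d h6
            omega
      · intro w hw hwi
        rcases hs.climbed_or hw with hw | ⟨c, hact, -⟩
        · exact (h4 w hw hwi).imp_right fun ⟨b, hb⟩ => ⟨b, hst hb⟩
        · have h5 := hI.up_mem c w hact
          exact .inl (h3 w hwi h5.2.1 (.inl h5.1))

theorem GReach.card_climbed_le (h : GReach T c₀ s g) (i : ℕ) :
    (g.climbed.filter (·.length = i)).card ≤ 2 * p := by
  have h0 : ((g.stolen.filter (·.length = i + 1)).image List.tail).card ≤ p :=
    Finset.card_image_le.trans (h.card_stolen_le (i + 1))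
  obtain ⟨A, hA, hcl⟩ : ∃ A : Finset Node, A.card ≤ p ∧
      ∀ w ∈ g.climbed, w.length = i → w ∈ A ∨ ∃ b, b :: w ∈ g.stolen := by
    rcases h.climbs_or i with ⟨-, h2⟩ | ⟨-, A, h2, -, h4⟩
    · exact ⟨∅, by simp, fun w hw hwi => .inr (h2 w hw hwi)⟩
    · exact ⟨A, h2, h4⟩
  have : g.climbed.filter (·.length = i) ⊆
      A ∪ (g.stolen.filter (·.length = i + 1)).image List.tail := by
    intro w hw
    rw [Finset.mem_filter] at hw
    rw [Finset.mem_union, Finset.mem_image]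
    rcases hcl w hw.1 hw.2 with h1 | ⟨b, hb⟩
    · exact .inl h1
    · exact .inr ⟨b :: w, Finset.mem_filter.2 ⟨hb, by simp [hw.2]⟩, rfl⟩
  have := (Finset.card_le_card this).trans (Finset.card_union_le _ _)
  omega

/-! ### The cost of an execution -/

section Cost

variable {k B : ℕ} {addr : ℕ → ℕ} {A : Node → Label} {wc : Node → ℕ}

/-- The blocks accessed by the task at `v` that the sequential execution has in its cache at the
position of a core, but that the core with cache contents `S` has not. -/
def deficit (T : BPTree) (addr : ℕ → ℕ) (B : ℕ) (A : Node → Label) (v : Node) (S : Finset ℕ) :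
    Activity → ℕ
  | .idle => 0
  | .down u => (((A u).inn ∩ T.blocksAt addr B v) \ S).card
  | .up u => if v <:+ u then (((A (true :: u)).out ∩ T.blocksAt addr B v) \ S).card else 0

/-- The number of blocks that a task brings into the cache of the sequential execution. -/
def gap (A : Node → Label) (v : Node) : ℕ := ((A v).out \ (A v).inn).card

open Classical in
/-- The misses of the completed up-pass codes in the sequential execution. -/
noncomputable def upCost (A : Node → Label) (D : Finset Node) (done : Set Node) : ℕ :=
  ∑ u ∈ D with u ∈ done, (A u).mu

open Classical in
/-- The gaps of the stolen tasks with a completed sibling. -/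
noncomputable def gapCost (A : Node → Label) (Z : Finset Node) (done : Set Node) : ℕ :=
  ∑ v ∈ Z with false :: v.tail ∈ done, gap A v

/-- The budget for the cache misses of an execution. -/
noncomputable def budget (T : BPTree) (addr : ℕ → ℕ) (B : ℕ) (A : Node → Label) (wc : Node → ℕ)
    (done : Set Node) (g : Ghost p) : ℕ :=
  ∑ u ∈ g.exec, (A u).md + upCost A g.exec done +
    ∑ v ∈ g.stolen, ((A v).inn ∩ T.blocksAt addr B v).card + gapCost A g.stolen done +
    ∑ u ∈ g.climbed, wc u

theorem upCost_mono {D D' : Finset Node} {done done' : Set Node} (hD : D ⊆ D')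
    (hd : done ⊆ done') : upCost A D done ≤ upCost A D' done' := by
  classical
  exact Finset.sum_le_sum_of_subset fun v hv => by
    simp only [Finset.mem_filter] at hv ⊢
    exact ⟨hD hv.1, hd hv.2⟩

theorem gapCost_mono {D D' : Finset Node} {done done' : Set Node} (hD : D ⊆ D')
    (hd : done ⊆ done') : gapCost A D done ≤ gapCost A D' done' := by
  classical
  exact Finset.sum_le_sum_of_subset fun v hv => by
    simp only [Finset.mem_filter] at hv ⊢
    exact ⟨hD hv.1, hd hv.2⟩

theorem upCost_insert {D : Finset Node} {done : Set Node} {u : Node} (hu : u ∈ D)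
    (hd : u ∉ done) : (A u).mu + upCost A D done ≤ upCost A D (insert u done) := by
  classical
  unfold upCost
  rw [← Finset.sum_insert (f := fun u => (A u).mu) (by simp [hd])]
  refine Finset.sum_le_sum_of_subset fun v hv => ?_
  simp only [Finset.mem_insert, Finset.mem_filter] at hv ⊢
  rcases hv with rfl | hv
  exacts [⟨hu, .inl rfl⟩, ⟨hv.1, .inr hv.2⟩]

theorem gap_add_gapCost_le {Z : Finset Node} {done : Set Node} {w : Node} (hZ : true :: w ∈ Z)
    (hd : false :: w ∉ done) :
    gap A (true :: w) + gapCost A Z done ≤ gapCost A Z (insert (false :: w) done) := by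
  classical
  unfold gapCost
  rw [← Finset.sum_insert (by simp [hd])]
  refine Finset.sum_le_sum_of_subset fun v hv => ?_
  simp only [Finset.mem_insert, Finset.mem_filter] at hv ⊢
  rcases hv with rfl | hv
  exacts [⟨hZ, .inl rfl⟩, ⟨hv.1, .inr hv.2⟩]

/-- The misses so far, and the deficits of all cores, are covered by the budget. -/
def Covered (T : BPTree) (addr : ℕ → ℕ) (k B : ℕ) (A : Node → Label) (wc : Node → ℕ) (s : State p)
    (g : Ghost p) : Prop :=
  ∃ (m : Fin p → ℕ) (S : Fin p → Finset ℕ),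
    (∀ c, Run k ∅ (reqs addr B (s.trace c)) (m c) (S c)) ∧
      ∑ c, (m c + deficit T addr B A (g.seg c) (S c) (s.act c)) ≤ budget T addr B A wc s.done g

/-- One core moves per step, so only its misses and deficit have to be compared with the growth of
the budget. The inequality is additive to avoid truncated subtraction. -/
theorem Covered.update (h : Covered T addr k B A wc s g) (c : Fin p)
    (ht : ∀ c₁ ≠ c, s'.trace c₁ = s.trace c₁) (ha : ∀ c₁ ≠ c, s'.act c₁ = s.act c₁)
    (hseg : ∀ c₁ ≠ c, g'.seg c₁ = g.seg c₁)
    (hc : ∀ m S, Run k ∅ (reqs addr B (s.trace c)) m S →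
      ∃ m' S', Run k ∅ (reqs addr B (s'.trace c)) m' S' ∧
        m' + deficit T addr B A (g'.seg c) S' (s'.act c) + budget T addr B A wc s.done g ≤
          m + deficit T addr B A (g.seg c) S (s.act c) + budget T addr B A wc s'.done g') :
    Covered T addr k B A wc s' g' := by
  obtain ⟨m, S, h1, h2⟩ := h
  obtain ⟨m', S', h3, h4⟩ := hc (m c) (S c) (h1 c)
  refine ⟨Function.update m c m', Function.update S c S', fun c₁ => ?_, ?_⟩
  · by_cases hc : c₁ = c
    · subst hc; simpa using h3
    · simpa [Function.update_of_ne hc, ht c₁ hc] using h1 c₁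
  · rw [← Finset.add_sum_erase _ _ (Finset.mem_univ c)] at h2 ⊢
    have : ∑ c₁ ∈ Finset.univ.erase c, (Function.update m c m' c₁ +
          deficit T addr B A (g'.seg c₁) (Function.update S c S' c₁) (s'.act c₁)) =
        ∑ c₁ ∈ Finset.univ.erase c, (m c₁ + deficit T addr B A (g.seg c₁) (S c₁) (s.act c₁)) := by
      refine Finset.sum_congr rfl fun c₁ hc₁ => ?_
      have hc := Finset.ne_of_mem_erase hc₁
      rw [Function.update_of_ne hc, Function.update_of_ne hc, ha c₁ hc, hseg c₁ hc]
    rw [this]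
    simp only [Function.update_self]
    omega

theorem valid_right_inn {L : Finset ℕ} {head tail : List Access} {l r : BPTree} {u : Node}
    (hA : Valid k B addr A [] T) (hu : T.task u = some (.fork L head tail l r)) :
    (A (true :: u)).inn = (A (false :: u)).out := (hA.task hu).2.2.2.1

/-- The deficit of a core that has completed `u` and goes on. -/
theorem Inv.deficit_finish {D Z : Finset Node} {seg : Fin p → Node} (h : Inv T s D Z seg)
    (hA : Valid k B addr A [] T) {c : Fin p} {u : Node} (t : List Access)
    (hat : (s.act c).At u) (S : Finset ℕ) :
    deficit T addr B A (seg c) S ((s.finish c t u).act c) + gapCost A Z s.done ≤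
      (if seg c <:+ u then (((A u).out ∩ T.blocksAt addr B (seg c)) \ S).card else 0) +
        gapCost A Z (insert u s.done) := by
  have hmono : gapCost A Z s.done ≤ gapCost A Z (insert u s.done) :=
    gapCost_mono subset_rfl (Set.subset_insert _ _)
  rcases u with _ | ⟨b, v⟩
  · simp only [State.finish, deficit, Function.update_self]; omega
  obtain ⟨τ, hτ⟩ := Option.isSome_iff_exists.1 (h.known_isSome _ (h.known_at hat))
  obtain ⟨L, head, tail, l, r, hv⟩ := BPTree.task_cons_some hτ
  have hin := valid_right_inn hA hv
  rcases h.finish_cases hat t with ⟨q, rfl, h1, h2, h3, h4⟩ | ⟨h1, h2, h3, h4⟩ | ⟨h1, h2, h3, h4⟩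
  · have hs : seg c <:+ false :: v :=
      (h.seg_queue c (true :: v) (by simp [h1])).trans (List.suffix_cons _ _)
    rw [h3, Function.update_self, if_pos hs, deficit, hin]
    omega
  · rw [h3, Function.update_self, deficit]
    split_ifs with hs hs' hs'
    · cases b
      -- The right sibling was complete before the left one, so it was stolen. The sequential cache
      -- has passed through it, and what it gained there is the gap. This is charged when the left
      -- sibling is completed, hence once per stolen task.
      · have hZ : true :: v ∈ Z :=
          (h.stolen v (.inl (h.mem_of_done _ h1))).resolve_right (h.notMem_done hat)
        have hj := gap_add_gapCost_le (A := A) hZ (h.notMem_done hat)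
        have hsub : ((A (true :: v)).out ∩ T.blocksAt addr B (seg c)) \ S ⊆
            (((A (false :: v)).out ∩ T.blocksAt addr B (seg c)) \ S) ∪
              ((A (true :: v)).out \ (A (true :: v)).inn) := by
          rw [hin]
          intro x
          simp only [Finset.mem_sdiff, Finset.mem_inter, Finset.mem_union]
          tauto
        have := (Finset.card_le_card hsub).trans (Finset.card_union_le _ _)
        unfold gap at hj
        omega
      · omega
    · exact absurd (hs.trans (List.suffix_cons _ _)) hs'
    · omega
    · omega
  · rw [h3, Function.update_self, deficit]
    omega

theorem reqs_mem_blocksAt {τ : BPTree} {u v : Node} {t : List Access} (hu : T.task u = some τ)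
    (hv : v <:+ u) (ht : ∀ a ∈ t, a ∈ τ.seq) : ∀ b ∈ reqs addr B t, b ∈ T.blocksAt addr B v := by
  intro b hb
  refine BPTree.blocksAt_subset addr B hv ?_
  rw [BPTree.blocksAt_eq addr B hu, BPTree.blocks_eq, List.mem_toFinset]
  obtain ⟨a, ha, rfl⟩ := List.mem_map.1 hb
  exact List.mem_map.2 ⟨a, ht a ha, rfl⟩

/-- A core continues with a piece of code that the sequential execution also runs. -/
theorem exists_run_append {τ : BPTree} {u v : Node} {t₀ t : List Access} {S₀ S₁ S : Finset ℕ}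
    {m m₀ : ℕ} (h : Run k S₀ (reqs addr B t) m S₁) (hS : S₀.card ≤ k) (hu : T.task u = some τ)
    (hv : v <:+ u) (ht : ∀ a ∈ t, a ∈ τ.seq) (h₀ : Run k ∅ (reqs addr B t₀) m₀ S) :
    ∃ m' S', Run k ∅ (reqs addr B (t₀ ++ t)) m' S' ∧
      m' + ((S₁ ∩ T.blocksAt addr B v) \ S').card ≤
        m₀ + m + ((S₀ ∩ T.blocksAt addr B v) \ S).card := by
  obtain ⟨m', S', h1, h2⟩ := h.simulate hS (reqs_mem_blocksAt hu hv ht) S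
  refine ⟨m₀ + m', S', ?_, by omega⟩
  rw [reqs_append]
  exact h₀.append h1

/-- Code inside the segment's task is imitated and charged to the labels; a steal is charged the
sequential contents relevant to the stolen task; a climb is charged to `mu` and `wc`. -/
theorem GStep.covered (hs : GStep T s g s' g') (hI : GInv T s g) (hk : 1 ≤ k)
    (hA : Valid k B addr A [] T)
    (hcl : ∀ u ∈ g.climbed, u ∈ s.done)
    (hwc : ∀ u L head tail l r, T.task u = some (.fork L head tail l r) →
      tail.length ≤ (A u).mu + wc u)
    (h : Covered T addr k B A wc s g) : Covered T addr k B A wc s' g' := by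
  cases hs with
  | fork c u L head tail l r hact hu =>
    refine h.update c (fun c₁ hc => Function.update_of_ne hc ..)
      (fun c₁ hc => Function.update_of_ne hc ..) (fun _ _ => rfl) fun m S hr => ?_
    have hV := hA.task hu
    obtain ⟨m', S', h1, h2⟩ := exists_run_append hV.2.2.1 hV.1 hu (hI.seg_down c u hact)
      (by simp only [BPTree.seq, List.mem_append]; tauto) hr
    refine ⟨m', S', by simpa using h1, ?_⟩
    simp only [Function.update_self, hact, deficit]
    have hb : (A u).md + budget T addr B A wc s.done g ≤
        budget T addr B A wc s.done { g with exec := insert u g.exec } := by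
      have := upCost_mono (A := A) (Finset.subset_insert u g.exec) (subset_refl s.done)
      simp only [budget, Finset.sum_insert (hI.down_notMem c u hact)]
      omega
    omega
  | leaf c u L code hact hu =>
    have htr : (s.finish c code u).trace = _ := Inv.finish_trace s c code u
    refine h.update c (fun c₁ hc => by rw [htr, Function.update_of_ne hc])
      (fun c₁ hc => by cases u <;> simp [State.finish, Function.update_of_ne hc])
      (fun _ _ => rfl) fun m S hr => ?_
    have hV := hA.task hu
    obtain ⟨m', S', h1, h2⟩ := exists_run_append hV.2.2 hV.1 hu (hI.seg_down c u hact)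
      (by simp only [BPTree.seq]; tauto) hr
    refine ⟨m', S', by simpa [htr] using h1, ?_⟩
    have h3 := hI.deficit_finish hA code (.inl hact) S'
    rw [if_pos (hI.seg_down c u hact)] at h3
    have h4 := upCost_mono (A := A) (Finset.subset_insert u g.exec) (Set.subset_insert u s.done)
    rw [Inv.finish_done]
    simp only [hact, deficit, budget, Finset.sum_insert (hI.down_notMem c u hact)] at h3 ⊢
    omega
  | up c u L head tail l r hact hu =>
    have htr : (s.finish c tail u).trace = _ := Inv.finish_trace s c tail u
    refine h.update c (fun c₁ hc => by rw [htr, Function.update_of_ne hc])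
      (fun c₁ hc => by cases u <;> simp [State.finish, Function.update_of_ne hc])
      (fun _ _ => rfl) fun m S hr => ?_
    have hV := hA.task hu
    have h3 := hI.deficit_finish hA tail (.inr hact)
    have hin := hI.up_mem c u hact
    have hmu := upCost_insert (A := A) hin.1 hin.2.1
    rw [Inv.finish_done]
    have hdef : deficit T addr B A (g.seg c) S (s.act c) = if g.seg c <:+ u then
        (((A (true :: u)).out ∩ T.blocksAt addr B (g.seg c)) \ S).card else 0 := by
      rw [hact]; rfl
    rw [hdef]
    by_cases hseg : g.seg c <:+ u
    · simp only [if_pos hseg] at h3 ⊢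
      obtain ⟨m', S', h1, h2⟩ := exists_run_append hV.2.2.2.2.1 hV.2.2.2.2.2.2.card_out hu hseg
        (by simp only [BPTree.seq, List.mem_append]; tauto) hr
      refine ⟨m', S', by simpa [htr] using h1, ?_⟩
      have h3 := h3 S'
      simp only [budget]
      omega
    · simp only [if_neg hseg] at h3 ⊢
      -- A climb: every access counts as a miss, and the contents may be forgotten because no
      -- deficit is kept above the segment's task.
      refine ⟨m + (reqs addr B tail).length, ∅, ?_, ?_⟩
      · rw [htr, Function.update_self, reqs_append]
        exact hr.append (Run.all_miss hk _ _)
      have h3 := h3 ∅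
      have h5 := hwc u _ _ _ _ _ hu
      simp only [budget, length_reqs, Finset.sum_insert fun h => hin.2.1 (hcl u h)]
      omega
  | steal c c' v q hact hq hround =>
    refine h.update c (fun _ _ => rfl) (fun c₁ hc => Function.update_of_ne hc ..)
      (fun c₁ hc => Function.update_of_ne hc ..) fun m S hr => ⟨m, S, hr, ?_⟩
    have hv : v ∉ g.stolen := (hI.queue_notMem c' v (by simp [hq])).2
    simp only [Function.update_self, hact, deficit]
    have h1 : (((A v).inn ∩ T.blocksAt addr B v) \ S).card ≤
        ((A v).inn ∩ T.blocksAt addr B v).card := Finset.card_le_card Finset.sdiff_subset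
    have h2 := gapCost_mono (A := A) (Finset.subset_insert v g.stolen) (subset_refl s.done)
    simp only [budget, Finset.sum_insert hv]
    omega

/-- Makes each climb a new element of the set: a node whose up-pass is about to run is not yet
complete. -/
theorem GReach.climbed_done (h : GReach T c₀ s g) : ∀ u ∈ g.climbed, u ∈ s.done := by
  induction h with
  | init => simp
  | step _ hs ih =>
    intro u hu
    cases hs with
    | up c v L head tail l r hact hv =>
      rw [Inv.finish_done]
      simp only at hu
      split_ifs at hu with h
      · exact .inr (ih u hu)
      · rcases Finset.mem_insert.1 hu with rfl | hu
        exacts [.inl rfl, .inr (ih u hu)]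
    | leaf => rw [Inv.finish_done]; exact .inr (ih u hu)
    | _ => exact ih u hu

theorem GReach.covered (h : GReach T c₀ s g) (hk : 1 ≤ k) (hA : Valid k B addr A [] T)
    (h0 : (A []).inn = ∅)
    (hwc : ∀ u L head tail l r, T.task u = some (.fork L head tail l r) →
      tail.length ≤ (A u).mu + wc u) : Covered T addr k B A wc s g := by
  induction h with
  | init =>
    refine ⟨fun _ => 0, fun _ => ∅, fun _ => .nil subset_rfl, ?_⟩
    refine (Finset.sum_eq_zero fun c _ => ?_).trans_le (Nat.zero_le _)
    simp only [State.init, Function.update_apply]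
    split_ifs <;> simp [deficit, h0]
  | step hr hs ih => exact hs.covered hr.inv hk hA hr.climbed_done hwc ih

/-- The cost of an execution: that of the sequential execution, and for each stolen task the
relevant cache contents and the gap, and for each climb the cost of the up-pass code. -/
theorem GReach.pwsMisses_le {M : ℕ} (h : GReach T c₀ s g) (hk : 1 ≤ M / B)
    (hA : Valid (M / B) B addr A [] T) (h0 : (A []).inn = ∅)
    (hwc : ∀ u L head tail l r, T.task u = some (.fork L head tail l r) →
      tail.length ≤ (A u).mu + wc u) :
    pwsMisses M B addr s ≤ weight A [] T +
      ∑ v ∈ g.stolen, (((A v).inn ∩ T.blocksAt addr B v).card + gap A v) +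
      ∑ u ∈ g.climbed, wc u := by
  obtain ⟨m, S, h1, h2⟩ := h.covered hk hA h0 hwc
  have h3 : pwsMisses M B addr s ≤ ∑ c, m c :=
    Finset.sum_le_sum fun c _ => cacheMisses_le_of_run (h1 c)
  have h4 : ∑ c, m c ≤ budget T addr B A wc s.done g :=
    (Finset.sum_le_sum fun c _ => Nat.le_add_right _ _).trans h2
  have h5 : ∑ u ∈ g.exec, (A u).md + upCost A g.exec s.done ≤ weight A [] T := by
    have h6 : upCost A g.exec s.done ≤ ∑ u ∈ g.exec, (A u).mu := by
      classical
      exact Finset.sum_le_sum_of_subset (Finset.filter_subset _ _)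
    have h7 : g.exec ⊆ BPTree.nodes [] T := fun u hu => by
      obtain ⟨τ, hτ⟩ := Option.isSome_iff_exists.1 (h.inv.known_isSome u (.inl hu))
      exact BPTree.mem_nodes_of_task hτ
    have h8 := Finset.sum_le_sum_of_subset (f := fun u => (A u).md + (A u).mu) h7
    have h9 := sum_nodes_le_weight A [] T
    rw [Finset.sum_add_distrib] at h8
    omega
  have h6 : gapCost A g.stolen s.done ≤ ∑ v ∈ g.stolen, gap A v := by
    classical
    exact Finset.sum_le_sum_of_subset (Finset.filter_subset _ _)
  rw [Finset.sum_add_distrib]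
  unfold budget at h4
  omega

end Cost

/-! ### Summation over the levels of the tree -/

/-- A sum over a set of nodes with at most `n` nodes at each level. -/
theorem sum_le_of_card_level_le {ι : Type*} {Z : Finset ι} {ω : ι → ℝ} {φ : ι → ℕ} {D : Finset ℕ}
    {G : ℕ → ℝ} {n : ℕ} (hφ : ∀ v ∈ Z, φ v ∈ D) (hω : ∀ v ∈ Z, ω v ≤ G (φ v))
    (hG : ∀ d ∈ D, 0 ≤ G d) (hn : ∀ d ∈ D, (Z.filter (φ · = d)).card ≤ n) :
    ∑ v ∈ Z, ω v ≤ n * ∑ d ∈ D, G d := by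
  rw [← Finset.sum_fiberwise_of_maps_to hφ, Finset.mul_sum]
  refine Finset.sum_le_sum fun d hd => ?_
  calc ∑ v ∈ Z with φ v = d, ω v ≤ ∑ v ∈ Z with φ v = d, G d :=
        Finset.sum_le_sum fun v hv => by
          obtain ⟨h1, h2⟩ := Finset.mem_filter.1 hv
          exact h2 ▸ hω v h1
    _ = (Z.filter (φ · = d)).card * G d := by simp
    _ ≤ n * G d := mul_le_mul_of_nonneg_right (by exact_mod_cast hn d hd) (hG d hd)

theorem sum_geom_le {α : ℝ} (hα0 : 0 < α) (hα1 : α < 1) (s : Finset ℕ) :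
    ∑ j ∈ s, α ^ j ≤ 1 / (1 - α) := by
  rw [one_div, ← tsum_geometric_of_lt_one hα0.le hα1]
  exact (summable_geometric_of_lt_one hα0.le hα1).sum_le_tsum s fun j _ => by positivity

section Levels

variable {M B : ℕ} {addr : ℕ → ℕ} {K α c₁ c₂ : ℝ} {f : ℝ → ℝ}

theorem IsBP.one_le_size (h : IsBP T addr K α c₁ c₂) (hα0 : 0 < α) (hc₁ : 0 < c₁) {u : Node}
    {τ : BPTree} (hu : T.task u = some τ) : 1 ≤ τ.size addr := by
  have h1 := (h.balance u τ hu).1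
  have h2 : (0 : ℝ) < T.size addr := by exact_mod_cast h.size_pos
  have h3 : (0 : ℝ) < τ.size addr := lt_of_lt_of_le (by positivity) h1
  exact_mod_cast h3

theorem IsBP.nonneg (h : IsBP T addr K α c₁ c₂) : 0 ≤ K :=
  (Nat.cast_nonneg _).trans (h.locals_le [] T rfl)

theorem IsBP.codeBound_floor (h : IsBP T addr K α c₁ c₂) (u : Node) (τ : BPTree)
    (hu : T.task u = some τ) : τ.CodeBound (⌊K⌋₊ : ℕ) := by
  have := h.code_le u τ hu
  cases τ with
  | leaf L code => exact Nat.cast_le.2 (Nat.le_floor this)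
  | fork L head tail l r =>
    exact ⟨Nat.cast_le.2 (Nat.le_floor this.1), Nat.cast_le.2 (Nat.le_floor this.2)⟩

/-- Labels for which the cache is empty above the level at which the tasks have about the size of
the cache. -/
theorem IsBP.exists_labels (h : IsBP T addr K α c₁ c₂) (hα1 : α < 1)
    (hc₁ : 0 < c₁) (hB : 1 ≤ B) (hBM : B ≤ M) :
    ∃ (e : ℕ) (A : Node → Label), c₁ * α ^ e * T.size addr < 2 * M ∧
      Valid (M / B) B addr A [] T ∧ (A []).inn = ∅ ∧
      (∀ v, v.length < e → (A v).inn = ∅ ∧ (A v).out = ∅) ∧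
      (∀ v L head tail l r, v.length + 1 < e →
        T.task v = some (.fork L head tail l r) → tail.length ≤ (A v).mu) ∧
      weight A [] T ≤ (2 + 3 * ⌊K⌋₊) * seqMisses M B addr T := by
  have hk : 1 ≤ M / B := (Nat.one_le_div_iff hB).2 hBM
  have hM : 1 ≤ M := hB.trans hBM
  have hr : (0 : ℝ) < T.size addr := by exact_mod_cast h.size_pos
  have hM' : (0 : ℝ) < 2 * M := by positivity
  have hex : ∃ e : ℕ, c₁ * α ^ e * T.size addr < 2 * M := by
    obtain ⟨e, he⟩ := exists_pow_lt_of_lt_one (y := α)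
      (show (0 : ℝ) < 2 * M / (c₁ * T.size addr) by positivity) hα1
    refine ⟨e, ?_⟩
    rw [lt_div_iff₀ (by positivity)] at he
    linarith
  obtain ⟨S₁, hrun⟩ := exists_run_cacheMisses (M := M) (B := B) addr T.seq hk
  classical
  -- `e` is the first depth at which the guaranteed size `c₁ α^e r` is below `2M`. All shallower
  -- tasks have at least `2M` words, hence at least `2 * (M / B)` blocks.
  have hspec := Nat.find_spec hex
  rcases he : Nat.find hex with _ | i
  · rw [he] at hspec
    obtain ⟨A, h1, h2, h3, h4⟩ := PWS.exists_labels [] T hrun (by simp)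
    refine ⟨0, A, hspec, h1, h2, by simp, by simp, ?_⟩
    rw [h4]
    exact Nat.le_mul_of_pos_left _ (by omega)
  · rw [he] at hspec
    have hbig : ∀ u τ, T.task u = some τ → u.length ≤ i →
        2 * (M / B) ≤ (τ.blocks addr B).card := by
      intro u τ hu hui
      have h1 := not_lt.1 (Nat.find_min hex (m := u.length) (by omega))
      have h2 : 2 * M ≤ τ.size addr := by exact_mod_cast h1.trans (h.balance u τ hu).1
      have h3 := BPTree.size_le_mul_card_blocks addr hB τ
      have h4 := Nat.div_mul_le_self M B
      have h5 : B * (2 * (M / B)) ≤ B * (τ.blocks addr B).card := by nlinarith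
      exact Nat.le_of_mul_le_mul_left h5 hB
    obtain ⟨A, h1, h2, h3, h4⟩ := exists_flushed_labels (i := i) hk h.codeBound_floor hbig [] T rfl
      (Nat.zero_le _) hrun (by simp)
    refine ⟨i + 1, A, hspec, h1, (h2 [] List.suffix_rfl (Nat.zero_le _)).1,
      fun v hv => h2 v List.nil_suffix (by omega),
      fun v L head tail l r hv => h3 v L head tail l r List.nil_suffix (by omega), ?_⟩
    unfold seqMisses
    omega

/-- The number of levels at which tasks may be smaller than the cache. -/
theorem le_of_le_mul_pow {R : ℝ} {j : ℕ} (hα0 : 0 < α) (hα1 : α < 1) (hR : 0 < R)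
    (h : α ≤ R * α ^ j) : (j : ℝ) ≤ 1 + Real.log R / Real.log α⁻¹ := by
  have hl : 0 < Real.log α⁻¹ := Real.log_pos ((one_lt_inv₀ hα0).2 hα1)
  have h1 := Real.log_le_log hα0 h
  rw [Real.log_mul hR.ne' (by positivity), Real.log_pow] at h1
  rw [Real.log_inv] at hl ⊢
  rw [← sub_le_iff_le_add', le_div_iff₀ hl]
  linarith

/-- Level `j` stands for depth `e + j` of steals and depth `e + j - 1` of climbs, where `e` is the
depth from `IsBP.exists_labels`. The labels make up-passes free only above depth `e - 1`, so one
more level of climbs is paid; therefore `N` is tested against `α` and not against 1. -/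
theorem pwsMisses_le_sum (hα0 : 0 < α) (hα1 : α < 1) (hc₁ : 0 < c₁)
    (hc₂ : 0 < c₂) (hB : 1 ≤ B) (hBM : B ≤ M) (hf0 : ∀ r, 1 ≤ r → 0 ≤ f r)
    (hf : MonotoneOn f (Set.Ici 1)) (h : IsBP T addr K α c₁ c₂) (hcf : CacheFriendly T addr B K f)
    (hs : IsPWSExecution T c₀ s) {N : ℕ}
    (hN : ∀ j : ℕ, α ≤ c₂ / c₁ * (2 * M) * α ^ j → j < N) :
    (pwsMisses M B addr s : ℝ) ≤ (2 + 3 * K) * seqMisses M B addr T +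
      p * (2 * K * ∑ j ∈ Finset.range N with 1 ≤ c₂ / c₁ * (2 * M) * α ^ j,
        (c₂ / c₁ * (2 * M) * α ^ j / B + f (c₂ / c₁ * (2 * M) * α ^ j))) + p * (2 * K * N) := by
  have hk : 1 ≤ M / B := (Nat.one_le_div_iff hB).2 hBM
  have hK := h.nonneg
  have hKf : (⌊K⌋₊ : ℝ) ≤ K := Nat.floor_le hK
  obtain ⟨e, A, he, hA, hA0, hA1, hA2, hw⟩ := h.exists_labels hα1 hc₁ hB hBM
  obtain ⟨g, hg⟩ := exists_gReach hs.1
  set R : ℝ := c₂ / c₁ * (2 * M) with hR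
  have hsize : ∀ u τ j, T.task u = some τ → u.length = e + j → (τ.size addr : ℝ) ≤ R * α ^ j := by
    intro u τ j hu huj
    refine (h.balance u τ hu).2.trans ?_
    calc c₂ * α ^ u.length * T.size addr = c₂ / c₁ * (c₁ * α ^ e * T.size addr) * α ^ j := by
          rw [huj, pow_add]; field_simp
      _ ≤ _ := by rw [hR]; gcongr
  have hknown : ∀ x, Known s g.exec x → ∃ τ, T.task x = some τ := fun x hx =>
    Option.isSome_iff_exists.1 (hg.inv.known_isSome x hx)
  have h1 := hg.pwsMisses_le (wc := fun u => if u.length + 1 < e then 0 else ⌊K⌋₊) hk hA hA0 (by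
    intro u L head tail l r hu
    split_ifs with hue
    · simpa using hA2 u L head tail l r hue hu
    · have := h.codeBound_floor u _ hu
      have : tail.length ≤ ⌊K⌋₊ := by exact_mod_cast this.2
      omega)
  have hcast : (pwsMisses M B addr s : ℝ) ≤ (2 + 3 * ⌊K⌋₊) * seqMisses M B addr T +
      ∑ v ∈ g.stolen, ((((A v).inn ∩ T.blocksAt addr B v).card : ℝ) + gap A v) +
      ∑ u ∈ g.climbed, (if u.length + 1 < e then 0 else (⌊K⌋₊ : ℝ)) := by
    have h2 : pwsMisses M B addr s ≤ (2 + 3 * ⌊K⌋₊) * seqMisses M B addr T +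
      ∑ v ∈ g.stolen, (((A v).inn ∩ T.blocksAt addr B v).card + gap A v) +
      ∑ u ∈ g.climbed, (if u.length + 1 < e then 0 else ⌊K⌋₊) := by omega
    exact_mod_cast h2
  have hstolen : ∑ v ∈ g.stolen, ((((A v).inn ∩ T.blocksAt addr B v).card : ℝ) + gap A v) ≤
      p * ∑ j ∈ Finset.range N with 1 ≤ R * α ^ j,
        2 * K * (R * α ^ j / B + f (R * α ^ j)) := by
    -- Steals above depth `e` are free, because the sequential cache is empty before and after such
    -- a task.
    have : ∑ v ∈ g.stolen, ((((A v).inn ∩ T.blocksAt addr B v).card : ℝ) + gap A v) =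
        ∑ v ∈ g.stolen with e ≤ v.length,
          ((((A v).inn ∩ T.blocksAt addr B v).card : ℝ) + gap A v) := by
      rw [Finset.sum_filter]
      refine Finset.sum_congr rfl fun v _ => ?_
      split_ifs with hv
      · rfl
      · simp [gap, hA1 v (not_le.1 hv)]
    rw [this]
    have hlev : ∀ v ∈ g.stolen.filter (e ≤ ·.length), ∃ τ, T.task v = some τ ∧
        (1 : ℝ) ≤ τ.size addr ∧ (τ.size addr : ℝ) ≤ R * α ^ (v.length - e) := by
      intro v hv
      obtain ⟨hv, hve⟩ := Finset.mem_filter.1 hv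
      obtain ⟨τ, hτ⟩ := hknown v (hg.inv.known_of_stolen v hv)
      exact ⟨τ, hτ, by exact_mod_cast h.one_le_size hα0 hc₁ hτ, hsize v τ _ hτ (by omega)⟩
    refine sum_le_of_card_level_le (φ := fun v => v.length - e) ?_ ?_ ?_ ?_
    · intro v hv
      obtain ⟨τ, -, h2, h3⟩ := hlev v hv
      rw [Finset.mem_filter, Finset.mem_range]
      exact ⟨hN _ (hα1.le.trans (h2.trans h3)), h2.trans h3⟩
    · intro v hv
      obtain ⟨τ, hτ, h2, h3⟩ := hlev v hv
      have h4 : ((A v).inn ∩ T.blocksAt addr B v).card ≤ (τ.blocks addr B).card := by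
        rw [BPTree.blocksAt_eq addr B hτ]
        exact Finset.card_le_card Finset.inter_subset_right
      have h5 : gap A v ≤ (τ.blocks addr B).card :=
        Finset.card_le_card (sdiff_le_iff.2 (hA.task hτ).out_subset)
      have h6 := hcf v τ hτ
      have h7 : f (τ.size addr) ≤ f (R * α ^ (v.length - e)) := hf h2 (h2.trans h3) h3
      have h8 : (τ.size addr : ℝ) / B ≤ R * α ^ (v.length - e) / B := by gcongr
      have h9 : K * ((τ.size addr : ℝ) / B + f (τ.size addr)) ≤
          K * (R * α ^ (v.length - e) / B + f (R * α ^ (v.length - e))) := by gcongr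
      have h4' : (((A v).inn ∩ T.blocksAt addr B v).card : ℝ) ≤ (τ.blocks addr B).card := by
        exact_mod_cast h4
      have h5' : (gap A v : ℝ) ≤ (τ.blocks addr B).card := by exact_mod_cast h5
      linarith
    · intro j hj
      have h2 := (Finset.mem_filter.1 hj).2
      have := hf0 _ h2
      positivity
    · intro j _
      refine (Finset.card_le_card fun v hv => ?_).trans (hg.card_stolen_le (e + j))
      simp only [Finset.mem_filter] at hv ⊢
      exact ⟨hv.1.1, by omega⟩
  have hclimbed : ∑ u ∈ g.climbed, (if u.length + 1 < e then 0 else (⌊K⌋₊ : ℝ)) ≤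
      ((2 * p : ℕ) : ℝ) * ∑ j ∈ Finset.range N, K := by
    have : ∑ u ∈ g.climbed, (if u.length + 1 < e then 0 else (⌊K⌋₊ : ℝ)) =
        ∑ u ∈ g.climbed with e ≤ u.length + 1, (⌊K⌋₊ : ℝ) := by
      rw [Finset.sum_filter]
      exact Finset.sum_congr rfl fun u _ => by split_ifs <;> first | rfl | omega
    rw [this]
    refine sum_le_of_card_level_le (φ := fun u => u.length + 1 - e) ?_ (fun _ _ => hKf)
      (fun _ _ => hK) ?_
    · intro u hu
      obtain ⟨hu, hue⟩ := Finset.mem_filter.1 hu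
      obtain ⟨τ, hτ⟩ := hknown u (.inl (hg.inv.mem_of_done u (hg.climbed_done u hu)))
      rw [Finset.mem_range]
      apply hN
      have h2 : (1 : ℝ) ≤ τ.size addr := by exact_mod_cast h.one_le_size hα0 hc₁ hτ
      calc α ≤ α * τ.size addr := le_mul_of_one_le_right hα0.le h2
        _ ≤ α * (c₂ * α ^ u.length * T.size addr) := by gcongr; exact (h.balance u τ hτ).2
        _ = c₂ * α ^ (e + (u.length + 1 - e)) * T.size addr := by
          rw [show e + (u.length + 1 - e) = u.length + 1 by omega]; ring
        _ = c₂ / c₁ * (c₁ * α ^ e * T.size addr) * α ^ (u.length + 1 - e) := by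
          rw [pow_add]; field_simp
        _ ≤ R * α ^ (u.length + 1 - e) := by rw [hR]; gcongr
    · intro j _
      -- For `e + j = 0` the depth `e + j - 1` would be truncated to 0, but there is no node to
      -- count.
      rcases Nat.eq_zero_or_pos (e + j) with h0 | h0
      · have : (g.climbed.filter (e ≤ ·.length + 1)).filter (fun u => u.length + 1 - e = j) = ∅ := by
          ext u; simp; omega
        rw [this]; simp
      · refine (Finset.card_le_card fun v hv => ?_).trans (hg.card_climbed_le (e + j - 1))
        simp only [Finset.mem_filter] at hv ⊢
        exact ⟨hv.1.1, by omega⟩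
  rw [← Finset.mul_sum] at hstolen
  have h3 : (2 + 3 * (⌊K⌋₊ : ℝ)) * seqMisses M B addr T ≤ (2 + 3 * K) * seqMisses M B addr T := by
    gcongr
  simp only [Finset.sum_const, Finset.card_range, nsmul_eq_mul, Nat.cast_mul, Nat.cast_ofNat]
    at hclimbed
  linarith

end Levels

/-! ### Estimates for the sums over the levels and for their number -/

section Bounds

variable {M B N : ℕ} {K α ρ : ℝ} {f : ℝ → ℝ}

theorem sum_levels_div_le (hα0 : 0 < α) (hα1 : α < 1) (hρ : 1 ≤ ρ) (s : Finset ℕ) :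
    ∑ j ∈ s, ρ * (2 * M) * α ^ j / B ≤ 2 * ρ / (1 - α) * ((M : ℝ) / B) := by
  calc ∑ j ∈ s, ρ * (2 * M) * α ^ j / B = 2 * ρ * ((M : ℝ) / B) * ∑ j ∈ s, α ^ j := by
        rw [Finset.mul_sum]; exact Finset.sum_congr rfl fun j _ => by ring
    _ ≤ 2 * ρ * ((M : ℝ) / B) * (1 / (1 - α)) := by gcongr; exact sum_geom_le hα0 hα1 s
    _ = _ := by ring

/-- Gives the `finsum` of the statement its intended value; with infinite support it would be 0 by
default. -/
theorem finite_levels (hα0 : 0 < α) (hα1 : α < 1) (hM : 1 ≤ M) :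
    {j : ℕ | 1 ≤ 2 * M * α ^ j}.Finite := by
  have hM' : (0 : ℝ) < M := by exact_mod_cast hM
  refine (Set.finite_lt_nat (⌊1 + Real.log (2 * M) / Real.log α⁻¹⌋₊ + 1)).subset fun j hj => ?_
  exact Nat.lt_succ_of_le (Nat.le_floor
    (le_of_le_mul_pow hα0 hα1 (by positivity) (hα1.le.trans hj)))

/-- Apart from a bounded number of levels, the levels of the tree are those of the sum in the
bound. -/
theorem sum_levels_le (hα0 : 0 < α) (hα1 : α < 1) (hρ : 1 ≤ ρ) (hM : 1 ≤ M)
    (hf0 : ∀ r, 1 ≤ r → 0 ≤ f r) (hf : MonotoneOn f (Set.Ici 1)) {J : ℕ} (hJ : ρ * α ^ J ≤ 1)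
    (hfM : f (ρ * (2 * M)) ≤ K * (ρ * (2 * M) / B)) (hK : 0 ≤ K) :
    ∑ j ∈ Finset.range N with 1 ≤ ρ * (2 * M) * α ^ j, f (ρ * (2 * M) * α ^ j) ≤
      J * K * (2 * ρ) * ((M : ℝ) / B) + ∑ᶠ j ∈ {j : ℕ | 1 ≤ 2 * M * α ^ j}, f (2 * M * α ^ j) := by
  have hM' : (1 : ℝ) ≤ M := by exact_mod_cast hM
  have hfin := finite_levels hα0 hα1 hM
  rw [finsum_mem_eq_finite_toFinset_sum _ hfin,
    ← Finset.sum_filter_add_sum_filter_not _ (fun j => j < J)]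
  -- The first `J` levels are bounded by the value of `f` at the largest size. Beyond them `ρ * α ^
  -- J ≤ 1` absorbs the factor `ρ`, and level `j` is compared with level `j - J`.
  refine add_le_add ?_ ?_
  · calc _ ≤ ∑ j ∈ Finset.range J, K * (2 * ρ) * ((M : ℝ) / B) := by
          refine (Finset.sum_le_sum fun j hj => ?_).trans
            (Finset.sum_le_sum_of_subset_of_nonneg (f := fun _ => K * (2 * ρ) * ((M : ℝ) / B))
              (t := Finset.range J) (fun j hj => ?_) fun _ _ _ => by positivity)
          · have h1 := (Finset.mem_filter.1 (Finset.mem_filter.1 hj).1).2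
            have h2 : ρ * (2 * M) * α ^ j ≤ ρ * (2 * M) :=
              mul_le_of_le_one_right (by positivity) (pow_le_one₀ hα0.le hα1.le)
            calc f (ρ * (2 * M) * α ^ j) ≤ f (ρ * (2 * M)) := hf h1 (h1.trans h2) h2
              _ ≤ K * (ρ * (2 * M) / B) := hfM
              _ = _ := by ring
          · exact Finset.mem_range.2 (Finset.mem_filter.1 hj).2
      _ = _ := by simp; ring
  · calc _ ≤ ∑ j ∈ ((Finset.range N).filter (1 ≤ ρ * (2 * M) * α ^ ·)).filter (¬ · < J),
            f (2 * M * α ^ (j - J)) := by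
          refine Finset.sum_le_sum fun j hj => ?_
          obtain ⟨h1, h2⟩ := Finset.mem_filter.1 hj
          have h1 := (Finset.mem_filter.1 h1).2
          have h3 : ρ * (2 * M) * α ^ j ≤ 2 * M * α ^ (j - J) := by
            calc ρ * (2 * M) * α ^ j = ρ * α ^ J * (2 * M * α ^ (j - J)) := by
                  rw [← Nat.add_sub_of_le (not_lt.1 h2), pow_add, Nat.add_sub_cancel_left]; ring
              _ ≤ 1 * (2 * M * α ^ (j - J)) := by gcongr
              _ = _ := one_mul _
          exact hf h1 (h1.trans h3) h3
      _ = ∑ j ∈ (((Finset.range N).filter (1 ≤ ρ * (2 * M) * α ^ ·)).filter (¬ · < J)).image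
            (· - J), f (2 * M * α ^ j) := by
          rw [Finset.sum_image]
          intro a ha b hb hab
          have h1 := (Finset.mem_filter.1 ha).2
          have h2 := (Finset.mem_filter.1 hb).2
          simp only at hab
          omega
      _ ≤ _ := by
          refine Finset.sum_le_sum_of_subset_of_nonneg ?_ ?_
          · intro i hi
            obtain ⟨j, hj, rfl⟩ := Finset.mem_image.1 hi
            obtain ⟨h1, h2⟩ := Finset.mem_filter.1 hj
            have h1 := (Finset.mem_filter.1 h1).2
            rw [Set.Finite.mem_toFinset]
            calc (1 : ℝ) ≤ ρ * (2 * M) * α ^ j := h1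
              _ = ρ * α ^ J * (2 * M * α ^ (j - J)) := by
                  rw [← Nat.add_sub_of_le (not_lt.1 h2), pow_add, Nat.add_sub_cancel_left]; ring
              _ ≤ 1 * (2 * M * α ^ (j - J)) := by gcongr
              _ = _ := one_mul _
          · intro j hj _
            exact hf0 _ (hfin.mem_toFinset.1 hj)

theorem sum_levels_const_le (hK : 0 ≤ K) (hfK : ∀ r, 1 ≤ r → f r ≤ K) :
    ∑ j ∈ Finset.range N with 1 ≤ ρ * (2 * M) * α ^ j, f (ρ * (2 * M) * α ^ j) ≤ K * N := by
  calc _ ≤ ∑ j ∈ Finset.range N with 1 ≤ ρ * (2 * M) * α ^ j, K :=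
        Finset.sum_le_sum fun j hj => hfK _ (Finset.mem_filter.1 hj).2
    _ ≤ ∑ j ∈ Finset.range N, K :=
        Finset.sum_le_sum_of_subset_of_nonneg (Finset.filter_subset _ _) fun _ _ _ => hK
    _ = _ := by simp; ring

/-- A geometric series of ratio `√α` with leading term of order `√M`, and `√M ≤ M / B` because `B² ≤
M`. -/
theorem sum_levels_sqrt_le (hα0 : 0 < α) (hα1 : α < 1) (hρ : 1 ≤ ρ) (hK : 0 ≤ K) (hB : 1 ≤ B)
    (hBM : (B : ℝ) ^ 2 ≤ M) (hfK : ∀ r, 1 ≤ r → f r ≤ K * √r) :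
    ∑ j ∈ Finset.range N with 1 ≤ ρ * (2 * M) * α ^ j, f (ρ * (2 * M) * α ^ j) ≤
      K * √(2 * ρ) / (1 - √α) * ((M : ℝ) / B) := by
  have hB' : (0 : ℝ) < B := by exact_mod_cast hB
  have hs0 : 0 < √α := Real.sqrt_pos.2 hα0
  have hs1 : √α < 1 := by rw [Real.sqrt_lt' one_pos]; simpa using hα1
  have hM : √(M : ℝ) ≤ M / B := by
    rw [le_div_iff₀ hB']
    calc √(M : ℝ) * B ≤ √(M : ℝ) * √M := by gcongr; exact Real.le_sqrt_of_sq_le hBM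
      _ = M := Real.mul_self_sqrt (by positivity)
  calc _ ≤ ∑ j ∈ Finset.range N with 1 ≤ ρ * (2 * M) * α ^ j, K * √(2 * ρ) * √M * √α ^ j := by
        refine Finset.sum_le_sum fun j hj => (hfK _ (Finset.mem_filter.1 hj).2).trans_eq ?_
        have hj : √(α ^ j) = √α ^ j := by
          rw [show α ^ j = (√α ^ j) ^ 2 by rw [← pow_mul, mul_comm, pow_mul, Real.sq_sqrt hα0.le],
            Real.sqrt_sq (by positivity)]
        rw [Real.sqrt_mul (by positivity), hj,
          show ρ * (2 * (M : ℝ)) = 2 * ρ * M by ring, Real.sqrt_mul (by positivity)]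
        ring
    _ = K * √(2 * ρ) * √M * ∑ j ∈ Finset.range N with 1 ≤ ρ * (2 * M) * α ^ j, √α ^ j := by
        rw [Finset.mul_sum]
    _ ≤ K * √(2 * ρ) * (M / B) * (1 / (1 - √α)) := by
        gcongr
        exact sum_geom_le hs0 hs1 _
    _ = _ := by ring

/-- The number of levels is logarithmic in the size of the cache. -/
theorem num_levels_le (hα0 : 0 < α) (hα1 : α < 1) (hρ : 1 ≤ ρ) (hB : 1 ≤ B) (hBM : B ≤ M) :
    2 + Real.log (ρ * (2 * M)) / Real.log α⁻¹ ≤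
      (2 + (Real.log (2 * ρ) + 1) / Real.log α⁻¹) * ((M : ℝ) / B + Real.logb 2 B) := by
  have hB' : (1 : ℝ) ≤ B := by exact_mod_cast hB
  have hBM' : (B : ℝ) ≤ M := by exact_mod_cast hBM
  have hM' : (1 : ℝ) ≤ M := hB'.trans hBM'
  have hl : 0 < Real.log α⁻¹ := Real.log_pos ((one_lt_inv₀ hα0).2 hα1)
  have hq : 1 ≤ (M : ℝ) / B := (one_le_div (by linarith)).2 hBM'
  have hlB : 0 ≤ Real.log B := Real.log_nonneg hB'
  have hlb : Real.log B ≤ Real.logb 2 B := by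
    rw [Real.logb, le_div_iff₀ (Real.log_pos one_lt_two)]
    have : Real.log 2 ≤ 1 := (Real.log_two_lt_d9.le).trans (by norm_num)
    nlinarith
  have hlq : Real.log ((M : ℝ) / B) ≤ M / B := (Real.log_le_sub_one_of_pos (by linarith)).trans
    (by linarith)
  have hlr : 0 ≤ Real.log (2 * ρ) := Real.log_nonneg (by linarith)
  have h1 : Real.log (ρ * (2 * M)) ≤ (Real.log (2 * ρ) + 1) * ((M : ℝ) / B + Real.logb 2 B) := by
    -- Splitting off `log B` leaves `log (M / B)`, which is at most `M / B`.
    have : Real.log (ρ * (2 * M)) = Real.log (2 * ρ) + Real.log (M / B) + Real.log B := by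
      rw [← Real.log_mul (by positivity) (by positivity),
        ← Real.log_mul (by positivity) (by positivity)]
      congr 1
      field_simp
    rw [this]
    nlinarith
  rw [add_mul, div_mul_eq_mul_div]
  refine add_le_add (by linarith) ?_
  gcongr

end Bounds

end PWS

/-! ### The three bounds -/

theorem mainTheorem5 (K α c₁ c₂ : ℝ) (hα0 : 0 < α) (hα1 : α < 1)
    (hc₁ : 0 < c₁) (hc₁' : c₁ ≤ 1) (hc₂ : 1 ≤ c₂) :
    ∃ C : ℝ, 0 < C ∧
      ∀ (p M B : ℕ) (f : ℝ → ℝ) (T : PWS.BPTree) (addr : ℕ → ℕ)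
        (c₀ : Fin p) (s : PWS.State p),
        1 ≤ B → B ≤ M →
        (∀ r, 1 ≤ r → 0 ≤ f r) → MonotoneOn f (Set.Ici 1) →
        PWS.IsBP T addr K α c₁ c₂ →
        PWS.CacheFriendly T addr B K f →
        (∀ r, 1 ≤ r → 2 * c₁ / c₂ * M ≤ r → f r ≤ K * (r / B)) →
        PWS.IsPWSExecution T c₀ s →
        ((PWS.pwsMisses M B addr s : ℝ) ≤
          C * (PWS.seqMisses M B addr T + p * ((M : ℝ) / B + Real.logb 2 B) +
            ∑ᶠ j ∈ {j : ℕ | 1 ≤ 2 * M * α ^ j}, p * f (2 * M * α ^ j))) ∧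
        ((B : ℝ) * Real.logb 2 B ≤ M → (∀ r, 1 ≤ r → f r ≤ K) →
          (PWS.pwsMisses M B addr s : ℝ) ≤
            C * (PWS.seqMisses M B addr T + p * ((M : ℝ) / B))) ∧
        ((B : ℝ) ^ 2 ≤ M → (∀ r, 1 ≤ r → f r ≤ K * √r) →
          (PWS.pwsMisses M B addr s : ℝ) ≤
            C * (PWS.seqMisses M B addr T + p * ((M : ℝ) / B))) := by
  -- A negative `K` is impossible, since it bounds a cardinality.
  rcases lt_or_ge K 0 with hK | hK
  · exact ⟨1, one_pos, fun p M B f T addr c₀ s _ _ _ _ h => absurd h.nonneg (not_le.2 hK)⟩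
  obtain ⟨ρ, hρdef⟩ : ∃ ρ, ρ = c₂ / c₁ := ⟨_, rfl⟩
  have hρ : 1 ≤ ρ := by rw [hρdef, one_le_div hc₁]; linarith
  obtain ⟨J, hJ⟩ : ∃ J : ℕ, ρ * α ^ J ≤ 1 := by
    obtain ⟨J, hJ⟩ := exists_pow_lt_of_lt_one (y := α) (show 0 < 1 / ρ by positivity) hα1
    rw [lt_div_iff₀ (by positivity)] at hJ
    exact ⟨J, by linarith⟩
  have hl : 0 < Real.log α⁻¹ := Real.log_pos ((one_lt_inv₀ hα0).2 hα1)
  have hs1 : √α < 1 := by rw [Real.sqrt_lt' one_pos]; simpa using hα1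
  have hα' : 0 < 1 - α := by linarith
  have hs1' : 0 < 1 - √α := by linarith
  obtain ⟨D, hD⟩ : ∃ D, D = 2 + (Real.log (2 * ρ) + 1) / Real.log α⁻¹ := ⟨_, rfl⟩
  have hD0 : 0 ≤ D := by
    have := Real.log_nonneg (show 1 ≤ 2 * ρ by linarith)
    rw [hD]; positivity
  -- the constants for the sums over the levels
  obtain ⟨a, ha⟩ : ∃ a, a = 2 * ρ / (1 - α) := ⟨_, rfl⟩
  obtain ⟨b, hb⟩ : ∃ b, b = J * K * (2 * ρ) := ⟨_, rfl⟩
  obtain ⟨d, hd⟩ : ∃ d, d = K * √(2 * ρ) / (1 - √α) := ⟨_, rfl⟩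
  have ha0 : 0 ≤ a := by rw [ha]; positivity
  have hb0 : 0 ≤ b := by rw [hb]; positivity
  have hd0 : 0 ≤ d := by rw [hd]; positivity
  -- `2 + 3 * K` is the price of emptying the cache, `a` covers the terms `size / B`, and `b + 1`,
  -- `2 * K * D` and `d` cover the sum of `f` in (i), (ii) and (iii). The number of levels takes `D`
  -- in (i) and `2 * D` otherwise.
  refine ⟨2 + 3 * K + 2 * K * (a + b + 1 + d + 2 * K * D + 2 * D), by positivity, ?_⟩
  intro p M B f T addr c₀ s hB hBM hf0 hf hT hcf hfM hs
  have hM : 1 ≤ M := hB.trans hBM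
  have hB' : (1 : ℝ) ≤ B := by exact_mod_cast hB
  have hM' : (1 : ℝ) ≤ M := by exact_mod_cast hM
  have hq : 0 ≤ (M : ℝ) / B := by positivity
  have hlB : 0 ≤ Real.logb 2 B := Real.logb_nonneg one_lt_two hB'
  have hR : 1 ≤ ρ * (2 * (M : ℝ)) := by nlinarith
  set N : ℕ := ⌊1 + Real.log (ρ * (2 * M)) / Real.log α⁻¹⌋₊ + 1 with hN
  have hND : (N : ℝ) ≤ D * ((M : ℝ) / B + Real.logb 2 B) := by
    refine le_trans ?_ (hD ▸ PWS.num_levels_le hα0 hα1 hρ hB hBM)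
    have := Nat.floor_le (a := 1 + Real.log (ρ * (2 * M)) / Real.log α⁻¹) (by
      have := Real.log_nonneg hR
      positivity)
    rw [hN]
    push_cast
    linarith
  have hmain := PWS.pwsMisses_le_sum (N := N) hα0 hα1 hc₁ (by linarith) hB hBM hf0 hf hT hcf hs (by
    intro j hj
    rw [← hρdef] at hj
    exact Nat.lt_succ_of_le (Nat.le_floor
      (PWS.le_of_le_mul_pow hα0 hα1 (by positivity) hj)))
  rw [← hρdef, Finset.sum_add_distrib] at hmain
  have hdiv := PWS.sum_levels_div_le (M := M) (B := B) hα0 hα1 hρ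
    ((Finset.range N).filter (1 ≤ ρ * (2 * M) * α ^ ·))
  rw [← ha] at hdiv
  set Q : ℝ := (PWS.seqMisses M B addr T : ℝ) with hQ
  have hQ0 : 0 ≤ Q := Nat.cast_nonneg _
  set F := ∑ j ∈ Finset.range N with 1 ≤ ρ * (2 * M) * α ^ j, f (ρ * (2 * M) * α ^ j) with hF
  have hp : (0 : ℝ) ≤ p := Nat.cast_nonneg _
  -- from a bound on the sum of `f` over the levels to a bound on the misses
  have key : ∀ x y W : ℝ, x ≤ b + 1 + d + 2 * K * D → y ≤ 2 * D → Q ≤ W →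
      p * ((M : ℝ) / B) ≤ W → p * F ≤ x * W → p * (N : ℝ) ≤ y * W →
      (PWS.pwsMisses M B addr s : ℝ) ≤
        (2 + 3 * K + 2 * K * (a + b + 1 + d + 2 * K * D + 2 * D)) * W := by
    intro x y W hx hy hQW hMW hFW hNW
    have hW : 0 ≤ W := hQ0.trans hQW
    calc _ ≤ (2 + 3 * K) * Q + p * (2 * K * (a * ((M : ℝ) / B) + F)) + p * (2 * K * N) := by
          refine hmain.trans ?_
          gcongr
      _ = (2 + 3 * K) * Q + 2 * K * (a * (p * ((M : ℝ) / B)) + p * F + p * N) := by ring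
      _ ≤ (2 + 3 * K) * W + 2 * K * (a * W + (b + 1 + d + 2 * K * D) * W + 2 * D * W) := by
          have h1 : x * W ≤ (b + 1 + d + 2 * K * D) * W := by gcongr
          have h2 : y * W ≤ 2 * D * W := by gcongr
          have h3 := hFW.trans h1
          have h4 := hNW.trans h2
          gcongr
      _ = _ := by ring
  have hlarge : (Real.logb 2 B ≤ (M : ℝ) / B) → p * (N : ℝ) ≤ 2 * D * (Q + p * ((M : ℝ) / B)) := by
    intro hlog
    calc p * (N : ℝ) ≤ p * (D * ((M : ℝ) / B + (M : ℝ) / B)) := by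
          gcongr; exact hND.trans (by gcongr)
      _ = 2 * D * (p * ((M : ℝ) / B)) := by ring
      _ ≤ _ := by gcongr; linarith
  refine ⟨?_, fun hBlog hfK => ?_, fun hB2 hfK => ?_⟩
  · rw [← mul_finsum_mem' _ _ (PWS.finite_levels hα0 hα1 hM), mul_add (p : ℝ)]
    set S := ∑ᶠ j ∈ {j : ℕ | 1 ≤ 2 * M * α ^ j}, f (2 * M * α ^ j) with hS
    have hS0 : 0 ≤ S := finsum_nonneg fun j => finsum_nonneg fun hj => hf0 _ hj
    have hFS : F ≤ b * ((M : ℝ) / B) + S := by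
      rw [hb]
      refine PWS.sum_levels_le hα0 hα1 hρ hM hf0 hf hJ (hfM _ hR ?_) hK
      -- The hypothesis on `f` applies at the size `ρ * (2 * M)`, as `c₁ / c₂ ≤ 1 ≤ ρ`.
      have : c₁ / c₂ ≤ 1 := (div_le_one (by linarith)).2 (by linarith)
      calc 2 * c₁ / c₂ * M = c₁ / c₂ * (2 * M) := by ring
        _ ≤ ρ * (2 * M) := by gcongr; linarith
    have hpS : 0 ≤ p * S := by positivity
    have hpq : 0 ≤ p * ((M : ℝ) / B) := by positivity
    have hpl : 0 ≤ p * Real.logb 2 B := by positivity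
    have hKD : 0 ≤ 2 * K * D := by positivity
    have hFp : p * F ≤ b * (p * ((M : ℝ) / B)) + p * S := by
      calc p * F ≤ p * (b * ((M : ℝ) / B) + S) := by gcongr
        _ = _ := by ring
    have hNp : p * (N : ℝ) ≤ D * (p * ((M : ℝ) / B) + p * Real.logb 2 B) := by
      calc p * (N : ℝ) ≤ p * (D * ((M : ℝ) / B + Real.logb 2 B)) := by gcongr
        _ = _ := by ring
    set W := Q + (p * ((M : ℝ) / B) + p * Real.logb 2 B) + p * S
    refine key (b + 1) D W (by linarith) (by linarith) (by linarith) (by linarith) ?_ ?_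
    · rw [add_mul, one_mul]
      refine hFp.trans (add_le_add ?_ (by linarith))
      gcongr
      linarith
    · refine hNp.trans ?_
      gcongr
      linarith
  · have hlog : Real.logb 2 B ≤ (M : ℝ) / B := by
      rw [le_div_iff₀ (by positivity)]; linarith
    refine key (2 * K * D) (2 * D) _ (by linarith) le_rfl
      (by linarith [mul_nonneg hp hq]) (by linarith) ?_ (hlarge hlog)
    calc p * F ≤ p * (K * N) := by gcongr; exact PWS.sum_levels_const_le hK hfK
      _ = K * (p * N) := by ring
      _ ≤ K * (2 * D * (Q + p * ((M : ℝ) / B))) :=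
          mul_le_mul_of_nonneg_left (hlarge hlog) hK
      _ = _ := by ring
  · have hlog : Real.logb 2 B ≤ (M : ℝ) / B := by
      rw [Real.logb, div_le_iff₀ (Real.log_pos one_lt_two)]
      have h1 : (B : ℝ) ≤ (M : ℝ) / B := by rw [le_div_iff₀ (by positivity)]; linarith
      -- `B ≤ 2 ^ B` gives `log B ≤ B` to base 2, and `B ≤ M / B` since `B² ≤ M`.
      have h2 : Real.log B ≤ (B : ℝ) * Real.log 2 := by
        rw [← Real.log_pow]
        refine Real.log_le_log (by linarith) ?_
        exact_mod_cast B.lt_two_pow_self.le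
      refine h2.trans ?_
      have := Real.log_pos one_lt_two
      gcongr
    refine key d (2 * D) _ (by linarith [mul_nonneg (mul_nonneg zero_le_two hK) hD0]) le_rfl
      (by linarith [mul_nonneg hp hq]) (by linarith) ?_ (hlarge hlog)
    calc p * F ≤ p * (d * ((M : ℝ) / B)) := by
          gcongr; rw [hd]; exact PWS.sum_levels_sqrt_le hα0 hα1 hρ hK hB hB2 hfK
      _ = d * (p * ((M : ℝ) / B)) := by ring
      _ ≤ _ := by gcongr; linarith
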